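/- Let $(\Theta,\mathcal B(\Theta))$ be a Borel subset of a Polish space with its Borel $\sigma$-algebra, let $\mu$ be a $\sigma$-finite measure on it, and let $\mathbb G$ be a stochastic kernel on $\Theta$ such that every $\mathbb G(\ell,\cdot)$ has a density $g(\ell,\cdot)$ with respect to $\mu$. Let $\mathcal H_\infty^{a\times b}$ be the set of measurable functions $\Theta\to\mathbb R^{a\times b}$ with $\mu$-essentially bounded spectral norm, $\mathcal{SH}_\infty^{a}$ the set of symmetric-matrix-valued elements of $\mathcal H_\infty^{a\times a}$, and $\mathcal H_\infty^{a+}$ the set of those elements of $\mathcal{SH}_\infty^a$ that are positive semidefinite $\mu$-a.e. Let $A\in\mathcal H_\infty^{n\times n}$, $G\in\mathcal H_\infty^{n\times m}$, $C\in\mathcal H_\infty^{p\times n}$. Below, $\{\vartheta(k)\}_{k\ge0}$ is a Markov chain in $\Theta$ with transition kernel $\mathbb G$, initial value $\vartheta(0)=\vartheta_0$ whose law is absolutely continuous with respect to $\mu$, and $\mathfrak F_k=\sigma(\vartheta(0),\dots,\vartheta(k))$; $x(0)=x_0\in\mathbb R^n$ is deterministic. For $\Phi\in\mathcal H^{n\times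 n}_\infty$, the system $x(k+1)=\Phi(\vartheta(k))x(k)$ is called exponentially mean-square stable (EMSS) if there are $\beta\ge1$, $\alpha\in(0,1)$ such that $\mathbf E\|x(k)\|^2\le\beta\alpha^k\|x_0\|^2$ for all $k\ge 0$, all $x_0$ and all such chains. A gain $K\in\mathcal H_\infty^{m\times n}$ exponentially stabilizes $(A,G|\mathbb G)$ if the system with $\Phi=A+GK$ is EMSS; $(A,G|\mathbb G)$ is exponentially mean-square stabilizable if such a $K$ exists; $(A;C|\mathbb G)$ is detectable if there is $H\in\mathcal H_\infty^{n\times p}$ such that the system with $\Phi=A+HC$ is EMSS. For $P\in\mathcal{SH}_\infty^n$ put $\mathcal E(P)(\ell)=\int_\Theta g(\ell,t)P(t)\,\mu(dt)$, $\mathcal G(P)=G^T\mathcal E(P)A$, $\mathcal R(P)=I+G^T\mathcal E(P)G$, $\mathcal M(P)=-\mathcal R(P)^{-1}\mathcal G(P)$, and consider the coupled algebraic Riccati equations $$P=A^T\mathcal E(P)A+C^TC-\mathcal G(P)^T\mathcal R(P)^{-1}\mathcal G(P)\quad\mu\text{-a.e.}\qquad(\ast)$$ A solution $P\in\mathcal{SH}_\infty^n$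 of $(\ast)$ (with $\mathcal R(P)$ invertible $\mu$-a.e.) is called stabilizing if the gain $\mathcal M(P)$ exponentially stabilizes $(A,G|\mathbb G)$. Suppose that $(A,G|\mathbb G)$ is exponentially mean-square stabilizable and $(A;C|\mathbb G)$ is detectable. Then $(\ast)$ has a stabilizing solution $P$, it is unique up to $\mu$-a.e. equality, $P\in\mathcal H_\infty^{n+}$, and $\mathcal R(P)\ge\xi I$ $\mu$-a.e. for some $\xi>0$. Furthermore, let a chain $\vartheta$ as above on a probability space and $x_0\in\mathbb R^n$ be given. For a control $u=\{u(k)\}_{k\ge 0}$ let $x$ be the state of $x(k+1)=A(\vartheta(k))x(k)+G(\vartheta(k))u(k)$, $x(0)=x_0$, and let $\mathbb U$ be the set of controls such that $u(k)$ is $\mathbb R^m$-valued and $\mathfrak F_k$-measurable for every $k$, $\sum_{k}\mathbf E\|u(k)\|^2<\infty$, and $u$ is exponentially stabilizing, i.e. $\mathbf E\|x(k)\|^2\le\beta\alpha^k\|x_0\|^2$ for all $k$, for some $\beta\ge1$, $\alpha\in(0,1)$. Then $$\inf_{u\in\mathbb U}\ \sum_{k=0}^\infty\mathbf E\big[x(k)^TC(\vartheta(k))^TC(\vartheta(k))x(k)+u(k)^Tu(k)\big]=x_0^T\,\mathbf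 E\{P(\vartheta_0)\}\,x_0,$$ and the infimum is attained by the control law $u^*(k)=\mathcal M(P)(\vartheta(k))x(k)$, $k\ge 0$, which belongs to $\mathbb U$. -/

import Mathlib

open MeasureTheory ProbabilityTheory Matrix
open scoped NNReal ENNReal Matrix.Norms.L2Operator

universe u v

namespace MJLS

noncomputable section

/-! ### Spaces of matrix-valued functions -/

/-- `Q ∈ 𝓗_∞^{a×b}`: a measurable matrix-valued function on `Θ` whose spectral norm is
`μ`-essentially bounded. -/
def MemHInf {Θ : Type u} [MeasurableSpace Θ] (μ : Measure Θ) {a b : ℕ}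
    (Q : Θ → Matrix (Fin a) (Fin b) ℝ) : Prop :=
  (∀ i j, Measurable fun ℓ => Q ℓ i j) ∧ ∃ c : ℝ, ∀ᵐ ℓ ∂μ, ‖Q ℓ‖ ≤ c

/-- `Q ∈ 𝓢𝓗_∞^{a}`: the symmetric-matrix-valued elements of `𝓗_∞^{a×a}`. -/
def MemSHInf {Θ : Type u} [MeasurableSpace Θ] (μ : Measure Θ) {a : ℕ}
    (Q : Θ → Matrix (Fin a) (Fin a) ℝ) : Prop :=
  MemHInf μ Q ∧ ∀ ℓ, (Q ℓ).IsSymm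

/-- `Q ∈ 𝓗_∞^{a+}`: the elements of `𝓢𝓗_∞^{a}` that are positive semidefinite
`μ`-almost everywhere. -/
def MemHInfPos {Θ : Type u} [MeasurableSpace Θ] (μ : Measure Θ) {a : ℕ}
    (Q : Θ → Matrix (Fin a) (Fin a) ℝ) : Prop :=
  MemSHInf μ Q ∧ ∀ᵐ ℓ ∂μ, (Q ℓ).PosSemidef

/-- `Q(ℓ) ≫ 0` `μ`-a.e.: there is `ξ > 0` with `Q(ℓ) ≥ ξ I` for `μ`-almost every `ℓ`. -/
def UnifPos {Θ : Type u} [MeasurableSpace Θ] (μ : Measure Θ) {a : ℕ}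
    (Q : Θ → Matrix (Fin a) (Fin a) ℝ) : Prop :=
  ∃ ξ : ℝ, 0 < ξ ∧ ∀ᵐ ℓ ∂μ, (Q ℓ - ξ • (1 : Matrix (Fin a) (Fin a) ℝ)).PosSemidef

/-! ### The Markov chain -/

/-- `𝔉_k`, the σ-field generated by `ϑ(0), …, ϑ(k)`. -/
abbrev history {Θ : Type u} [MeasurableSpace Θ] {Ω : Type v} (θ : ℕ → Ω → Θ) (k : ℕ) :
    MeasurableSpace Ω :=
  ⨆ i : ℕ, ⨆ _ : i ≤ k, MeasurableSpace.comap (θ i) inferInstance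

/-- `θ` is a time-homogeneous Markov chain on `(Ω, ℙ)` with transition kernel `κ`:
`ℙ(θ(k+1) ∈ Λ | 𝔉_k) = κ(θ(k), Λ)` almost surely. -/
structure IsMarkovChain {Θ : Type u} [MeasurableSpace Θ] (κ : Kernel Θ Θ)
    {Ω : Type v} [MeasurableSpace Ω] (Pr : Measure Ω) (θ : ℕ → Ω → Θ) : Prop where
  measurable : ∀ k, Measurable (θ k)
  transition : ∀ (k : ℕ) (Λ : Set Θ), MeasurableSet Λ →
    Pr[(θ (k + 1) ⁻¹' Λ).indicator (fun _ => (1 : ℝ)) | history θ k]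
      =ᵐ[Pr] fun ω => (κ (θ k ω)).real Λ

/-! ### State equations, stability, stabilizability, detectability -/

/-- The squared Euclidean norm `‖w‖² = wᵀ w`. -/
def sqNorm {a : ℕ} (w : Fin a → ℝ) : ℝ := w ⬝ᵥ w

theorem sqNorm_eq {a : ℕ} (w : Fin a → ℝ) : sqNorm w = ‖WithLp.toLp 2 w‖ ^ 2 := by
  rw [EuclideanSpace.norm_sq_eq]
  simp [sqNorm, dotProduct, sq]

/-- `𝐄‖w‖²`, as an extended nonnegative real. -/
def meanSq {Ω : Type v} [MeasurableSpace Ω] (Pr : Measure Ω) {a : ℕ}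
    (w : Ω → Fin a → ℝ) : ℝ≥0∞ :=
  ∫⁻ ω, ENNReal.ofReal (sqNorm (w ω)) ∂Pr

/-- The state of `x(k+1) = A(ϑ(k)) x(k)`, `x(0) = x₀`. -/
def freeState {Θ : Type u} {Ω : Type v} {n : ℕ} (A : Θ → Matrix (Fin n) (Fin n) ℝ)
    (θ : ℕ → Ω → Θ) (x₀ : Fin n → ℝ) : ℕ → Ω → Fin n → ℝ
  | 0 => fun _ => x₀
  | k + 1 => fun ω => A (θ k ω) *ᵥ freeState A θ x₀ k ω

/-- The state of `x(k+1) = A(ϑ(k)) x(k) + G(ϑ(k)) u(k)`, `x(0) = x₀`. -/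
def state {Θ : Type u} {Ω : Type v} {n m : ℕ} (A : Θ → Matrix (Fin n) (Fin n) ℝ)
    (G : Θ → Matrix (Fin n) (Fin m) ℝ) (θ : ℕ → Ω → Θ) (u : ℕ → Ω → Fin m → ℝ)
    (x₀ : Fin n → ℝ) : ℕ → Ω → Fin n → ℝ
  | 0 => fun _ => x₀
  | k + 1 => fun ω => A (θ k ω) *ᵥ state A G θ u x₀ k ω + G (θ k ω) *ᵥ u k ω

/-- `(A|𝔾)` is exponentially mean-square stable: there are `β ≥ 1` and `α ∈ (0,1)` with
`𝐄‖x(k)‖² ≤ β α^k ‖x₀‖²` for all `k`, all deterministic `x₀` and every Markov chain with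
kernel `κ` whose initial law is absolutely continuous with respect to `μ`.  (The path space
`ℕ → Θ` lies in `Type u`, so every law of such a chain occurs.) -/
def EMSS {Θ : Type u} [MeasurableSpace Θ] (μ : Measure Θ) (κ : Kernel Θ Θ) {n : ℕ}
    (A : Θ → Matrix (Fin n) (Fin n) ℝ) : Prop :=
  ∃ β α : ℝ, 1 ≤ β ∧ 0 < α ∧ α < 1 ∧
    ∀ (Ω : Type u) [MeasurableSpace Ω] (Pr : Measure Ω) [IsProbabilityMeasure Pr]
      (θ : ℕ → Ω → Θ), IsMarkovChain κ Pr θ → Pr.map (θ 0) ≪ μ →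
      ∀ (x₀ : Fin n → ℝ) (k : ℕ),
        meanSq Pr (freeState A θ x₀ k) ≤ ENNReal.ofReal (β * α ^ k * sqNorm x₀)

/-- The feedback `u(k) = K(ϑ(k)) x(k)` exponentially stabilizes `(A, G|𝔾)`. -/
def IsStabilizingGain {Θ : Type u} [MeasurableSpace Θ] (μ : Measure Θ) (κ : Kernel Θ Θ)
    {n m : ℕ} (A : Θ → Matrix (Fin n) (Fin n) ℝ) (G : Θ → Matrix (Fin n) (Fin m) ℝ)
    (K : Θ → Matrix (Fin m) (Fin n) ℝ) : Prop :=
  MemHInf μ K ∧ EMSS μ κ (fun ℓ => A ℓ + G ℓ * K ℓ)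

/-- `(A, G|𝔾)` is exponentially mean-square stabilizable. -/
def IsStabilizable {Θ : Type u} [MeasurableSpace Θ] (μ : Measure Θ) (κ : Kernel Θ Θ)
    {n m : ℕ} (A : Θ → Matrix (Fin n) (Fin n) ℝ) (G : Θ → Matrix (Fin n) (Fin m) ℝ) : Prop :=
  ∃ K : Θ → Matrix (Fin m) (Fin n) ℝ, IsStabilizingGain μ κ A G K

/-- `(A; C|𝔾)` is detectable. -/
def IsDetectable {Θ : Type u} [MeasurableSpace Θ] (μ : Measure Θ) (κ : Kernel Θ Θ)
    {n p : ℕ} (A : Θ → Matrix (Fin n) (Fin n) ℝ) (C : Θ → Matrix (Fin p) (Fin n) ℝ) : Prop :=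
  ∃ H : Θ → Matrix (Fin n) (Fin p) ℝ, MemHInf μ H ∧ EMSS μ κ (fun ℓ => A ℓ + H ℓ * C ℓ)

/-! ### The coupled algebraic Riccati equations -/

/-- `𝓔(U)(ℓ) = ∫ g(ℓ,t) U(t) μ(dt)`, entrywise. -/
def opE {Θ : Type u} [MeasurableSpace Θ] (μ : Measure Θ) (g : Θ → Θ → ℝ≥0) {n : ℕ}
    (U : Θ → Matrix (Fin n) (Fin n) ℝ) (ℓ : Θ) : Matrix (Fin n) (Fin n) ℝ :=
  Matrix.of fun i j => ∫ t, (g ℓ t : ℝ) * U t i j ∂μ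

/-- `𝓣_Q(U)(ℓ) = Q(ℓ)ᵀ 𝓔(U)(ℓ) Q(ℓ)`. -/
def opT {Θ : Type u} [MeasurableSpace Θ] (μ : Measure Θ) (g : Θ → Θ → ℝ≥0) {n a : ℕ}
    (Q : Θ → Matrix (Fin n) (Fin a) ℝ) (U : Θ → Matrix (Fin n) (Fin n) ℝ) (ℓ : Θ) :
    Matrix (Fin a) (Fin a) ℝ :=
  (Q ℓ)ᵀ * opE μ g U ℓ * Q ℓ

/-- `𝓖(P)(ℓ) = G(ℓ)ᵀ 𝓔(P)(ℓ) A(ℓ)`. -/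
def opG {Θ : Type u} [MeasurableSpace Θ] (μ : Measure Θ) (g : Θ → Θ → ℝ≥0) {n m : ℕ}
    (A : Θ → Matrix (Fin n) (Fin n) ℝ) (G : Θ → Matrix (Fin n) (Fin m) ℝ)
    (P : Θ → Matrix (Fin n) (Fin n) ℝ) (ℓ : Θ) : Matrix (Fin m) (Fin n) ℝ :=
  (G ℓ)ᵀ * opE μ g P ℓ * A ℓ

/-- `𝓡(P)(ℓ) = R(ℓ) + 𝓣_G(P)(ℓ)`. -/
def opR {Θ : Type u} [MeasurableSpace Θ] (μ : Measure Θ) (g : Θ → Θ → ℝ≥0) {n m : ℕ}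
    (G : Θ → Matrix (Fin n) (Fin m) ℝ) (R : Θ → Matrix (Fin m) (Fin m) ℝ)
    (P : Θ → Matrix (Fin n) (Fin n) ℝ) (ℓ : Θ) : Matrix (Fin m) (Fin m) ℝ :=
  R ℓ + opT μ g G P ℓ

/-- `𝓜(P)(ℓ) = -𝓡(P)(ℓ)⁻¹ 𝓖(P)(ℓ)`. -/
def opM {Θ : Type u} [MeasurableSpace Θ] (μ : Measure Θ) (g : Θ → Θ → ℝ≥0) {n m : ℕ}
    (A : Θ → Matrix (Fin n) (Fin n) ℝ) (G : Θ → Matrix (Fin n) (Fin m) ℝ)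
    (R : Θ → Matrix (Fin m) (Fin m) ℝ) (P : Θ → Matrix (Fin n) (Fin n) ℝ) (ℓ : Θ) :
    Matrix (Fin m) (Fin n) ℝ :=
  -((opR μ g G R P ℓ)⁻¹ * opG μ g A G P ℓ)

/-- `P ∈ 𝓢𝓗_∞^n` solves the coupled AREs
`P = 𝓣_A(P) + Q - 𝓖(P)ᵀ 𝓡(P)⁻¹ 𝓖(P)` `μ`-a.e., the inverse being a genuine one. -/
def IsARESolution {Θ : Type u} [MeasurableSpace Θ] (μ : Measure Θ) (g : Θ → Θ → ℝ≥0) {n m : ℕ}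
    (A : Θ → Matrix (Fin n) (Fin n) ℝ) (G : Θ → Matrix (Fin n) (Fin m) ℝ)
    (Q : Θ → Matrix (Fin n) (Fin n) ℝ) (R : Θ → Matrix (Fin m) (Fin m) ℝ)
    (P : Θ → Matrix (Fin n) (Fin n) ℝ) : Prop :=
  MemSHInf μ P ∧ (∀ᵐ ℓ ∂μ, IsUnit (opR μ g G R P ℓ)) ∧
    ∀ᵐ ℓ ∂μ, P ℓ = opT μ g A P ℓ + Q ℓ
      - (opG μ g A G P ℓ)ᵀ * (opR μ g G R P ℓ)⁻¹ * opG μ g A G P ℓ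

/-- `P` is a stabilizing solution of the coupled AREs: `u(k) = 𝓜(P)(ϑ(k)) x(k)`
exponentially stabilizes `(A, G|𝔾)`. -/
def IsStabilizingSolution {Θ : Type u} [MeasurableSpace Θ] (μ : Measure Θ) (κ : Kernel Θ Θ)
    (g : Θ → Θ → ℝ≥0) {n m : ℕ}
    (A : Θ → Matrix (Fin n) (Fin n) ℝ) (G : Θ → Matrix (Fin n) (Fin m) ℝ)
    (Q : Θ → Matrix (Fin n) (Fin n) ℝ) (R : Θ → Matrix (Fin m) (Fin m) ℝ)
    (P : Θ → Matrix (Fin n) (Fin n) ℝ) : Prop :=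
  IsARESolution μ g A G Q R P ∧ IsStabilizingGain μ κ A G (opM μ g A G R P)

/-! ### The infinite horizon LQ problem -/

/-- The admissible controls `𝕌`: adapted sequences `u ∈ l²(ℕ; ℝ^m)` that exponentially
stabilize `(A, G|𝔾)`, i.e. the resulting state satisfies `𝐄‖x(k)‖² ≤ β α^k ‖x₀‖²` for some
`β ≥ 1`, `α ∈ (0,1)`. -/
def admissible {Θ : Type u} [MeasurableSpace Θ] {Ω : Type v} [MeasurableSpace Ω]
    (Pr : Measure Ω) {n m : ℕ} (A : Θ → Matrix (Fin n) (Fin n) ℝ)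
    (G : Θ → Matrix (Fin n) (Fin m) ℝ) (θ : ℕ → Ω → Θ) (x₀ : Fin n → ℝ) :
    Set (ℕ → Ω → Fin m → ℝ) :=
  {u | (∀ k, Measurable[history θ k] (u k)) ∧
    ∑' k, meanSq Pr (u k) < ∞ ∧
    ∃ β α : ℝ, 1 ≤ β ∧ 0 < α ∧ α < 1 ∧
      ∀ k, meanSq Pr (state A G θ u x₀ k) ≤ ENNReal.ofReal (β * α ^ k * sqNorm x₀)}

/-- The cost `J_S(x₀, ϑ₀; u) = ∑_k 𝐄[x(k)ᵀ C(ϑ(k))ᵀ C(ϑ(k)) x(k) + u(k)ᵀ u(k)]`, with values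
in `[0, ∞]` (the integrands are nonnegative). -/
def lqCost {Θ : Type u} {Ω : Type v} [MeasurableSpace Ω]
    (Pr : Measure Ω) {n m p : ℕ} (A : Θ → Matrix (Fin n) (Fin n) ℝ)
    (G : Θ → Matrix (Fin n) (Fin m) ℝ) (C : Θ → Matrix (Fin p) (Fin n) ℝ)
    (θ : ℕ → Ω → Θ) (x₀ : Fin n → ℝ) (u : ℕ → Ω → Fin m → ℝ) : ℝ≥0∞ :=
  ∑' k, ∫⁻ ω, ENNReal.ofReal
    (state A G θ u x₀ k ω ⬝ᵥ ((C (θ k ω))ᵀ * C (θ k ω)) *ᵥ state A G θ u x₀ k ω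
      + u k ω ⬝ᵥ u k ω) ∂Pr

/-- `𝐄{P(ϑ₀)}`, entrywise. -/
def meanInit {Θ : Type u} {Ω : Type v} [MeasurableSpace Ω] (Pr : Measure Ω) {n : ℕ}
    (θ : ℕ → Ω → Θ) (P : Θ → Matrix (Fin n) (Fin n) ℝ) : Matrix (Fin n) (Fin n) ℝ :=
  Matrix.of fun i j => ∫ ω, P (θ 0 ω) i j ∂Pr

end

end MJLS

/-! Mean-square stability of `F` is equivalent to the existence of a Lyapunov function: a bounded `V
≥ 0` with `𝓣_F(V) + I ≤ V` almost everywhere. Such a `V` makes `𝐄[xᵀ V x]` contract along the chain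
(`IsLyapunov.emss`). Conversely, moments under all absolutely continuous initial laws give almost
everywhere bounds on the iterates `𝓣_F^k(I)`, and a finite sum of them, doubled, is a Lyapunov
function (`EMSS.exists_isLyapunov`). After this translation, existence is a question about matrix
inequalities valid `μ`-almost everywhere.

Everything else rests on `completion_of_squares`: the Riccati map is the minimum over `w` of
next-stage value plus stage cost, attained at `𝓜(P) x`. It is therefore monotone, and value
iteration from `0` increases. A stabilizing gain supplies a bounded supersolution above the
iterates, so they converge to a bounded solution `P ≥ 0` (`IsLyapunov.exists_eq_riccati`).

Detectability makes `P` stabilizing. Under the gain `M = 𝓜(P)` the value `P` decreases by `‖Cx‖² +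
‖Mx‖²`, and `A + GM` differs from the stable `A + HC` by a term seen only through `Cx` and `Mx`. A
large multiple of `P` added to a Lyapunov function of `A + HC` absorbs that term
(`IsLyapunov.of_detectable`).

For uniqueness, the difference of two stabilizing solutions satisfies `D = Φ₁ᵀ 𝓔(D) Φ₂` with both
closed loops stable; iterating this equation forces `D = 0` (`ae_eq_zero_of_fixed_point`).

For optimality, the completed square summed along a trajectory writes the cost up to time `N`, plus
the value at `N`, as the initial value plus nonnegative squares
(`IsMarkovChain.stageCost_add_weightedSq`). The terminal value vanishes for admissible controls, and
the squares vanish for the feedback. -/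

namespace MJLS

/-! ### Quadratic forms -/

/-- The quadratic form `xᵀ M x`. -/
def quad {a : ℕ} (M : Matrix (Fin a) (Fin a) ℝ) (x : Fin a → ℝ) : ℝ := x ⬝ᵥ M *ᵥ x

section Quad

variable {a b : ℕ}

theorem sqNorm_nonneg (x : Fin a → ℝ) : 0 ≤ sqNorm x := by
  rw [sqNorm_eq]; positivity

theorem quad_add (M N : Matrix (Fin a) (Fin a) ℝ) (x : Fin a → ℝ) :
    quad (M + N) x = quad M x + quad N x := by
  simp [quad, add_mulVec, dotProduct_add]

theorem quad_sub (M N : Matrix (Fin a) (Fin a) ℝ) (x : Fin a → ℝ) :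
    quad (M - N) x = quad M x - quad N x := by
  simp [quad, sub_mulVec, dotProduct_sub]

theorem quad_smul (c : ℝ) (M : Matrix (Fin a) (Fin a) ℝ) (x : Fin a → ℝ) :
    quad (c • M) x = c * quad M x := by
  simp [quad, smul_mulVec]

theorem quad_one (x : Fin a → ℝ) : quad 1 x = sqNorm x := by
  simp [quad, sqNorm]

theorem dotProduct_transpose_mulVec (Q : Matrix (Fin a) (Fin b) ℝ) (x : Fin b → ℝ)
    (y : Fin a → ℝ) : x ⬝ᵥ Qᵀ *ᵥ y = (Q *ᵥ x) ⬝ᵥ y := by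
  rw [dotProduct_mulVec, vecMul_transpose]

theorem quad_conj (Q : Matrix (Fin a) (Fin b) ℝ) (M : Matrix (Fin a) (Fin a) ℝ)
    (x : Fin b → ℝ) : quad (Qᵀ * M * Q) x = quad M (Q *ᵥ x) := by
  simp [quad, ← mulVec_mulVec, dotProduct_transpose_mulVec]

theorem quad_gram (Q : Matrix (Fin a) (Fin b) ℝ) (x : Fin b → ℝ) :
    quad (Qᵀ * Q) x = sqNorm (Q *ᵥ x) := by
  simp [quad, ← mulVec_mulVec, dotProduct_transpose_mulVec, sqNorm]

theorem dotProduct_mulVec_comm {M : Matrix (Fin a) (Fin a) ℝ} (hM : M.IsSymm)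
    (x y : Fin a → ℝ) : x ⬝ᵥ M *ᵥ y = y ⬝ᵥ M *ᵥ x := by
  rw [dotProduct_mulVec, ← mulVec_transpose, hM.eq, dotProduct_comm]

theorem quad_add_vec {M : Matrix (Fin a) (Fin a) ℝ} (hM : M.IsSymm) (x y : Fin a → ℝ) :
    quad M (x + y) = quad M x + 2 * (x ⬝ᵥ M *ᵥ y) + quad M y := by
  simp only [quad, mulVec_add, dotProduct_add, add_dotProduct]
  rw [dotProduct_mulVec_comm hM y x]; ring

theorem quad_smul_vec (M : Matrix (Fin a) (Fin a) ℝ) (c : ℝ) (x : Fin a → ℝ) :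
    quad M (c • x) = c ^ 2 * quad M x := by
  simp [quad, mulVec_smul]; ring

theorem quad_neg_vec (M : Matrix (Fin a) (Fin a) ℝ) (x : Fin a → ℝ) :
    quad M (-x) = quad M x := by
  simp [quad, mulVec_neg]

/-- Expand `0 ≤ quad M (ε x - y)` and divide by `ε`. -/
theorem two_mul_dotProduct_mulVec_le {M : Matrix (Fin a) (Fin a) ℝ} (hM : M.IsSymm)
    (h0 : ∀ x, 0 ≤ quad M x) {ε : ℝ} (hε : 0 < ε) (x y : Fin a → ℝ) :
    2 * (x ⬝ᵥ M *ᵥ y) ≤ ε * quad M x + ε⁻¹ * quad M y := by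
  have h := h0 (ε • x + -y)
  rw [quad_add_vec hM, quad_smul_vec, quad_neg_vec] at h
  simp only [mulVec_neg, smul_dotProduct, dotProduct_neg, smul_eq_mul] at h
  have h2 := mul_nonneg (inv_nonneg.2 hε.le) h
  have e : ε⁻¹ * (ε ^ 2 * quad M x + 2 * (ε * -(x ⬝ᵥ M *ᵥ y)) + quad M y)
      = ε * quad M x - 2 * (x ⬝ᵥ M *ᵥ y) + ε⁻¹ * quad M y := by
    field_simp
    ring
  linarith

theorem quad_add_vec_le {M : Matrix (Fin a) (Fin a) ℝ} (hM : M.IsSymm)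
    (h0 : ∀ x, 0 ≤ quad M x) {ε : ℝ} (hε : 0 < ε) (x y : Fin a → ℝ) :
    quad M (x + y) ≤ (1 + ε) * quad M x + (1 + ε⁻¹) * quad M y := by
  rw [quad_add_vec hM]
  linarith [two_mul_dotProduct_mulVec_le hM h0 hε x y]

theorem sqNorm_add_le (x y : Fin a → ℝ) : sqNorm (x + y) ≤ 2 * sqNorm x + 2 * sqNorm y := by
  have := quad_add_vec_le (M := (1 : Matrix (Fin a) (Fin a) ℝ)) isSymm_one
    (fun z => by rw [quad_one]; exact sqNorm_nonneg z) one_pos x y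
  simp only [quad_one] at this
  linarith

theorem sqNorm_mulVec_le (Q : Matrix (Fin a) (Fin b) ℝ) (x : Fin b → ℝ) :
    sqNorm (Q *ᵥ x) ≤ ‖Q‖ ^ 2 * sqNorm x := by
  have h := l2_opNorm_mulVec Q (WithLp.toLp 2 x)
  rw [sqNorm_eq, sqNorm_eq, ← mul_pow]
  exact pow_le_pow_left₀ (norm_nonneg _) h 2

theorem abs_quad_le (M : Matrix (Fin a) (Fin a) ℝ) (x : Fin a → ℝ) :
    |quad M x| ≤ ‖M‖ * sqNorm x := by
  have h := l2_opNorm_mulVec M (WithLp.toLp 2 x)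
  have h2 := abs_real_inner_le_norm (WithLp.toLp 2 x) (WithLp.toLp 2 (M *ᵥ x))
  have e : inner ℝ (WithLp.toLp 2 x) (WithLp.toLp 2 (M *ᵥ x)) = quad M x := by
    simp [quad, dotProduct_comm, EuclideanSpace.inner_eq_star_dotProduct]
  rw [e] at h2
  rw [sqNorm_eq]
  calc |quad M x| ≤ ‖WithLp.toLp 2 x‖ * (‖M‖ * ‖WithLp.toLp 2 x‖) :=
        h2.trans (mul_le_mul_of_nonneg_left h (norm_nonneg _))
    _ = _ := by ring

theorem sqNorm_single (i : Fin a) (c : ℝ) : sqNorm (Pi.single i c) = c ^ 2 := by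
  simp [sqNorm]; ring

theorem abs_apply_le_norm (Q : Matrix (Fin a) (Fin b) ℝ) (i : Fin a) (j : Fin b) :
    |Q i j| ≤ ‖Q‖ := by
  have h := sqNorm_mulVec_le Q (Pi.single j 1)
  rw [sqNorm_single] at h
  have h2 : (Q i j) ^ 2 ≤ sqNorm (Q *ᵥ Pi.single j 1) := by
    simp only [mulVec_single_one, sqNorm, dotProduct, col_apply]
    rw [sq]
    exact Finset.single_le_sum (f := fun i => Q i j * Q i j)
      (fun k _ => mul_self_nonneg _) (Finset.mem_univ i)
  exact abs_le_of_sq_le_sq (by linarith) (norm_nonneg _)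

/-- Equivalence of norms in finite dimension. The constant depends on the dimensions alone, hence is
uniform in the point of `Θ`. -/
theorem exists_norm_le_mul (a b : ℕ) : ∃ K : ℝ, 0 ≤ K ∧ ∀ (Q : Matrix (Fin a) (Fin b) ℝ) (c : ℝ),
    0 ≤ c → (∀ i j, |Q i j| ≤ c) → ‖Q‖ ≤ K * c := by
  refine ⟨∑ i : Fin a, ∑ j : Fin b, ‖(Matrix.single i j 1 : Matrix (Fin a) (Fin b) ℝ)‖,
    by positivity, fun Q c hc h => ?_⟩
  conv_lhs => rw [matrix_eq_sum_single Q]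
  simp only [Finset.sum_mul]
  refine (norm_sum_le _ _).trans (Finset.sum_le_sum fun i _ =>
    (norm_sum_le _ _).trans (Finset.sum_le_sum fun j _ => ?_))
  have : (Matrix.single i j (Q i j) : Matrix (Fin a) (Fin b) ℝ)
      = Q i j • Matrix.single i j 1 := by
    simp
  rw [this, norm_smul, mul_comm, Real.norm_eq_abs]
  exact mul_le_mul_of_nonneg_left (h i j) (norm_nonneg _)

/-- Polarization: finitely many test vectors determine all entries. This matters where the
exceptional null set, or the convergence, depends on the vector. -/
theorem apply_eq_quad {M : Matrix (Fin a) (Fin a) ℝ} (hM : M.IsSymm) (i j : Fin a) :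
    4 * M i j = quad M (Pi.single i 1 + Pi.single j 1)
      - quad M (Pi.single i 1 + -Pi.single j 1) := by
  rw [quad_add_vec hM, quad_add_vec hM, quad_neg_vec]
  simp only [mulVec_neg, dotProduct_neg]
  simp
  ring

theorem abs_apply_le_of_quad_le {M : Matrix (Fin a) (Fin a) ℝ} (hM : M.IsSymm) {c : ℝ}
    (h0 : ∀ x, 0 ≤ quad M x) (i j : Fin a)
    (h1 : quad M (Pi.single i 1 + Pi.single j 1) ≤ c)
    (h2 : quad M (Pi.single i 1 + -Pi.single j 1) ≤ c) : |M i j| ≤ c := by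
  have h := apply_eq_quad hM i j
  have h3 := h0 (Pi.single i 1 + Pi.single j 1)
  have h4 := h0 (Pi.single i 1 + -Pi.single j 1)
  rw [abs_le]
  constructor <;> linarith

theorem sqNorm_single_add_le (i j : Fin a) :
    sqNorm (Pi.single i 1 + Pi.single j 1 : Fin a → ℝ) ≤ 4 ∧
      sqNorm (Pi.single i 1 + -Pi.single j 1 : Fin a → ℝ) ≤ 4 := by
  refine ⟨(sqNorm_add_le _ _).trans ?_, (sqNorm_add_le _ _).trans ?_⟩
  · rw [sqNorm_single, sqNorm_single]; norm_num
  · rw [← Pi.single_neg, sqNorm_single, sqNorm_single]; norm_num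

theorem posSemidef_iff_quad {M : Matrix (Fin a) (Fin a) ℝ} (hM : M.IsSymm) :
    M.PosSemidef ↔ ∀ x, 0 ≤ quad M x := by
  constructor
  · intro h x
    simpa [quad] using h.dotProduct_mulVec_nonneg x
  · intro h
    refine .of_dotProduct_mulVec_nonneg ?_ fun x => by simpa [quad] using h x
    rw [IsHermitian, conjTranspose_eq_transpose_of_trivial]
    exact hM

theorem eq_of_forall_dotProduct_mulVec_eq {M N : Matrix (Fin a) (Fin b) ℝ}
    (h : ∀ x y, x ⬝ᵥ M *ᵥ y = x ⬝ᵥ N *ᵥ y) : M = N := by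
  ext i j
  simpa using h (Pi.single i 1) (Pi.single j 1)

end Quad

/-! ### Closure properties of `𝓗_∞` -/

section HInf

variable {Θ : Type u} [MeasurableSpace Θ] {μ : Measure Θ} {a b c : ℕ}

theorem memHInf_of_entries {Q : Θ → Matrix (Fin a) (Fin b) ℝ}
    (hm : ∀ i j, Measurable fun ℓ => Q ℓ i j) {r : ℝ} (hr : 0 ≤ r)
    (h : ∀ᵐ ℓ ∂μ, ∀ i j, |Q ℓ i j| ≤ r) : MemHInf μ Q := by
  obtain ⟨K, -, hK⟩ := exists_norm_le_mul a b
  exact ⟨hm, K * r, h.mono fun ℓ hℓ => hK _ _ hr hℓ⟩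

theorem MemHInf.exists_pos {Q : Θ → Matrix (Fin a) (Fin b) ℝ} (h : MemHInf μ Q) :
    ∃ r : ℝ, 0 < r ∧ ∀ᵐ ℓ ∂μ, ‖Q ℓ‖ ≤ r := by
  obtain ⟨-, r, hr⟩ := h
  exact ⟨max r 1, by positivity, hr.mono fun ℓ h => h.trans (le_max_left _ _)⟩

theorem MemHInf.add {Q R : Θ → Matrix (Fin a) (Fin b) ℝ} (hQ : MemHInf μ Q)
    (hR : MemHInf μ R) : MemHInf μ fun ℓ => Q ℓ + R ℓ := by
  obtain ⟨mQ, q, hq⟩ := hQ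
  obtain ⟨mR, r, hr⟩ := hR
  refine ⟨fun i j => (mQ i j).add (mR i j), q + r, ?_⟩
  filter_upwards [hq, hr] with ℓ h1 h2
  exact (norm_add_le _ _).trans (add_le_add h1 h2)

theorem MemHInf.neg {Q : Θ → Matrix (Fin a) (Fin b) ℝ} (hQ : MemHInf μ Q) :
    MemHInf μ fun ℓ => -Q ℓ := by
  obtain ⟨mQ, q, hq⟩ := hQ
  exact ⟨fun i j => (mQ i j).neg, q, hq.mono fun ℓ h => by rwa [norm_neg]⟩

theorem MemHInf.sub {Q R : Θ → Matrix (Fin a) (Fin b) ℝ} (hQ : MemHInf μ Q)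
    (hR : MemHInf μ R) : MemHInf μ fun ℓ => Q ℓ - R ℓ := by
  simpa only [sub_eq_add_neg] using hQ.add hR.neg

theorem MemHInf.const_smul {Q : Θ → Matrix (Fin a) (Fin b) ℝ} (hQ : MemHInf μ Q) (r : ℝ) :
    MemHInf μ fun ℓ => r • Q ℓ := by
  obtain ⟨mQ, q, hq⟩ := hQ
  refine ⟨fun i j => (mQ i j).const_mul r, |r| * q, hq.mono fun ℓ h => ?_⟩
  rw [norm_smul, Real.norm_eq_abs]
  exact mul_le_mul_of_nonneg_left h (abs_nonneg r)

theorem MemHInf.mul {Q : Θ → Matrix (Fin a) (Fin b) ℝ} {R : Θ → Matrix (Fin b) (Fin c) ℝ}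
    (hQ : MemHInf μ Q) (hR : MemHInf μ R) : MemHInf μ fun ℓ => Q ℓ * R ℓ := by
  obtain ⟨q, -, hq⟩ := hQ.exists_pos
  obtain ⟨r, -, hr⟩ := hR.exists_pos
  refine ⟨fun i j => ?_, q * r, ?_⟩
  · simp only [mul_apply]
    exact Finset.measurable_sum _ fun k _ => (hQ.1 i k).mul (hR.1 k j)
  · filter_upwards [hq, hr] with ℓ h1 h2
    exact (l2_opNorm_mul _ _).trans
      (mul_le_mul h1 h2 (norm_nonneg _) ((norm_nonneg _).trans h1))

theorem MemHInf.transpose {Q : Θ → Matrix (Fin a) (Fin b) ℝ} (hQ : MemHInf μ Q) :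
    MemHInf μ fun ℓ => (Q ℓ)ᵀ := by
  obtain ⟨mQ, q, hq⟩ := hQ
  refine ⟨fun i j => mQ j i, q, hq.mono fun ℓ h => ?_⟩
  change ‖(Q ℓ)ᵀ‖ ≤ q
  rwa [← conjTranspose_eq_transpose_of_trivial, l2_opNorm_conjTranspose]

theorem memHInf_const (M : Matrix (Fin a) (Fin b) ℝ) : MemHInf μ fun _ => M :=
  ⟨fun _ _ => measurable_const, ‖M‖, .of_forall fun _ => le_rfl⟩

theorem memSHInf_one : MemSHInf μ fun _ => (1 : Matrix (Fin a) (Fin a) ℝ) :=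
  ⟨memHInf_const _, fun _ => isSymm_one⟩

theorem MemSHInf.add {Q R : Θ → Matrix (Fin a) (Fin a) ℝ} (hQ : MemSHInf μ Q)
    (hR : MemSHInf μ R) : MemSHInf μ fun ℓ => Q ℓ + R ℓ :=
  ⟨hQ.1.add hR.1, fun ℓ => (hQ.2 ℓ).add (hR.2 ℓ)⟩

theorem MemSHInf.sub {Q R : Θ → Matrix (Fin a) (Fin a) ℝ} (hQ : MemSHInf μ Q)
    (hR : MemSHInf μ R) : MemSHInf μ fun ℓ => Q ℓ - R ℓ :=
  ⟨hQ.1.sub hR.1, fun ℓ => (hQ.2 ℓ).sub (hR.2 ℓ)⟩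

theorem MemSHInf.const_smul {Q : Θ → Matrix (Fin a) (Fin a) ℝ} (hQ : MemSHInf μ Q) (r : ℝ) :
    MemSHInf μ fun ℓ => r • Q ℓ :=
  ⟨hQ.1.const_smul r, fun ℓ => (hQ.2 ℓ).smul r⟩

theorem MemHInf.exists_quad_le {M : Θ → Matrix (Fin a) (Fin a) ℝ} (h : MemHInf μ M) :
    ∃ r : ℝ, 0 < r ∧ ∀ᵐ ℓ ∂μ, ∀ x, quad (M ℓ) x ≤ r * sqNorm x := by
  obtain ⟨r, h0, hr⟩ := h.exists_pos
  refine ⟨r, h0, hr.mono fun ℓ h x => (le_abs_self _).trans ((abs_quad_le _ _).trans ?_)⟩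
  exact mul_le_mul_of_nonneg_right h (sqNorm_nonneg x)

theorem MemHInf.exists_sqNorm_le {Q : Θ → Matrix (Fin a) (Fin b) ℝ} (h : MemHInf μ Q) :
    ∃ r : ℝ, 0 < r ∧ ∀ᵐ ℓ ∂μ, ∀ x, sqNorm (Q ℓ *ᵥ x) ≤ r * sqNorm x := by
  obtain ⟨r, h0, hr⟩ := h.exists_pos
  refine ⟨r ^ 2, by positivity, hr.mono fun ℓ h x => (sqNorm_mulVec_le _ _).trans ?_⟩
  exact mul_le_mul_of_nonneg_right (pow_le_pow_left₀ (norm_nonneg _) h 2) (sqNorm_nonneg x)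

theorem memSHInf_of_quad_le {M : Θ → Matrix (Fin a) (Fin a) ℝ}
    (hm : ∀ i j, Measurable fun ℓ => M ℓ i j) (hs : ∀ ℓ, (M ℓ).IsSymm)
    (h0 : ∀ᵐ ℓ ∂μ, ∀ x, 0 ≤ quad (M ℓ) x) {r : ℝ} (hr : 0 ≤ r)
    (h1 : ∀ᵐ ℓ ∂μ, ∀ x, quad (M ℓ) x ≤ r * sqNorm x) : MemSHInf μ M := by
  refine ⟨memHInf_of_entries hm (r := r * 4) (by positivity) ?_, hs⟩
  filter_upwards [h0, h1] with ℓ h0 h1 i j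
  exact abs_apply_le_of_quad_le (hs ℓ) h0 i j
    ((h1 _).trans (mul_le_mul_of_nonneg_left (sqNorm_single_add_le i j).1 hr))
    ((h1 _).trans (mul_le_mul_of_nonneg_left (sqNorm_single_add_le i j).2 hr))

end HInf

/-! ### The averaging operator `𝓔` -/

/-- Every `κ ℓ` has density `g ℓ` with respect to `μ`. -/
structure HasDensity {Θ : Type u} [MeasurableSpace Θ] (μ : Measure Θ) (κ : Kernel Θ Θ)
    (g : Θ → Θ → ℝ≥0) : Prop where
  measurable : ∀ ℓ, Measurable (g ℓ)
  eq_withDensity : ∀ ℓ, κ ℓ = μ.withDensity (fun t => (g ℓ t : ℝ≥0∞))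

theorem dotProduct_integral_mulVec {X : Type*} [MeasurableSpace X] {ν : Measure X} {n : ℕ}
    {U : X → Matrix (Fin n) (Fin n) ℝ} (hi : ∀ i j, Integrable (fun t => U t i j) ν)
    (x y : Fin n → ℝ) :
    x ⬝ᵥ (Matrix.of fun i j => ∫ t, U t i j ∂ν) *ᵥ y = ∫ t, x ⬝ᵥ U t *ᵥ y ∂ν := by
  simp only [dotProduct, mulVec, of_apply]
  rw [integral_finsetSum _ fun i _ =>
    (integrable_finsetSum _ fun j _ => (hi i j).mul_const (y j)).const_mul (x i)]
  refine Finset.sum_congr rfl fun i _ => ?_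
  rw [integral_const_mul, integral_finsetSum _ fun j _ => (hi i j).mul_const (y j)]
  congr 1
  refine Finset.sum_congr rfl fun j _ => ?_
  rw [integral_mul_const]

theorem integrable_dotProduct_mulVec {X : Type*} [MeasurableSpace X] {ν : Measure X} {n : ℕ}
    {U : X → Matrix (Fin n) (Fin n) ℝ} (hi : ∀ i j, Integrable (fun t => U t i j) ν)
    (x y : Fin n → ℝ) : Integrable (fun t => x ⬝ᵥ U t *ᵥ y) ν := by
  simp only [dotProduct, mulVec]
  exact integrable_finsetSum _ fun i _ => (integrable_finsetSum _ fun j _ =>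
    (hi i j).mul_const (y j)).const_mul (x i)

section Averaging

variable {Θ : Type u} [MeasurableSpace Θ] {μ : Measure Θ} {κ : Kernel Θ Θ} {g : Θ → Θ → ℝ≥0}
  {n a b : ℕ}

theorem HasDensity.absolutelyContinuous (h : HasDensity μ κ g) (ℓ : Θ) : κ ℓ ≪ μ := by
  rw [h.eq_withDensity]
  exact withDensity_absolutelyContinuous _ _

theorem HasDensity.ae (h : HasDensity μ κ g) {q : Θ → Prop} (hq : ∀ᵐ t ∂μ, q t) (ℓ : Θ) :
    ∀ᵐ t ∂κ ℓ, q t :=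
  (h.absolutelyContinuous ℓ).ae_le hq

theorem HasDensity.opE_apply (h : HasDensity μ κ g) (U : Θ → Matrix (Fin n) (Fin n) ℝ) (ℓ : Θ)
    (i j : Fin n) : opE μ g U ℓ i j = ∫ t, U t i j ∂κ ℓ := by
  rw [h.eq_withDensity, integral_withDensity_eq_integral_smul (h.measurable ℓ)]
  rfl

theorem HasDensity.integrable_entry [IsMarkovKernel κ] (h : HasDensity μ κ g)
    {U : Θ → Matrix (Fin n) (Fin n) ℝ} (hU : MemHInf μ U) (ℓ : Θ) (i j : Fin n) :
    Integrable (fun t => U t i j) (κ ℓ) := by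
  obtain ⟨hm, r, hr⟩ := hU
  refine Integrable.of_bound (hm i j).aestronglyMeasurable r ?_
  exact (h.ae hr ℓ).mono fun t ht => (abs_apply_le_norm _ i j).trans ht

theorem HasDensity.memHInf_opE [IsMarkovKernel κ] (h : HasDensity μ κ g)
    {U : Θ → Matrix (Fin n) (Fin n) ℝ} (hU : MemHInf μ U) : MemHInf μ (opE μ g U) := by
  obtain ⟨r, h0, hr⟩ := hU.exists_pos
  refine memHInf_of_entries (fun i j => ?_) h0.le (.of_forall fun ℓ i j => ?_)
  · simp only [h.opE_apply]
    exact ((hU.1 i j).stronglyMeasurable.integral_kernel).measurable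
  · rw [h.opE_apply, ← Real.norm_eq_abs]
    have : ∀ᵐ t ∂κ ℓ, ‖U t i j‖ ≤ r :=
      (h.ae hr ℓ).mono fun t ht => (abs_apply_le_norm _ i j).trans ht
    simpa using norm_integral_le_of_norm_le_const this

theorem HasDensity.dotProduct_opE_mulVec [IsMarkovKernel κ] (h : HasDensity μ κ g)
    {U : Θ → Matrix (Fin n) (Fin n) ℝ} (hU : MemHInf μ U) (ℓ : Θ) (x y : Fin n → ℝ) :
    x ⬝ᵥ opE μ g U ℓ *ᵥ y = ∫ t, x ⬝ᵥ U t *ᵥ y ∂κ ℓ := by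
  rw [← dotProduct_integral_mulVec (h.integrable_entry hU ℓ)]
  congr 2
  ext i j
  exact h.opE_apply U ℓ i j

theorem HasDensity.integrable_dotProduct [IsMarkovKernel κ] (h : HasDensity μ κ g)
    {U : Θ → Matrix (Fin n) (Fin n) ℝ} (hU : MemHInf μ U) (ℓ : Θ) (x y : Fin n → ℝ) :
    Integrable (fun t => x ⬝ᵥ U t *ᵥ y) (κ ℓ) :=
  integrable_dotProduct_mulVec (h.integrable_entry hU ℓ) x y

theorem HasDensity.quad_opE [IsMarkovKernel κ] (h : HasDensity μ κ g)
    {U : Θ → Matrix (Fin n) (Fin n) ℝ} (hU : MemHInf μ U) (ℓ : Θ) (x : Fin n → ℝ) :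
    quad (opE μ g U ℓ) x = ∫ t, quad (U t) x ∂κ ℓ :=
  h.dotProduct_opE_mulVec hU ℓ x x

theorem HasDensity.integrable_quad [IsMarkovKernel κ] (h : HasDensity μ κ g)
    {U : Θ → Matrix (Fin n) (Fin n) ℝ} (hU : MemHInf μ U) (ℓ : Θ) (x : Fin n → ℝ) :
    Integrable (fun t => quad (U t) x) (κ ℓ) :=
  h.integrable_dotProduct hU ℓ x x

theorem HasDensity.quad_opE_mono [IsMarkovKernel κ] (h : HasDensity μ κ g)
    {U V : Θ → Matrix (Fin n) (Fin n) ℝ} (hU : MemHInf μ U) (hV : MemHInf μ V)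
    (hle : ∀ᵐ t ∂μ, ∀ x, quad (U t) x ≤ quad (V t) x) (ℓ : Θ) (x : Fin n → ℝ) :
    quad (opE μ g U ℓ) x ≤ quad (opE μ g V ℓ) x := by
  rw [h.quad_opE hU, h.quad_opE hV]
  exact integral_mono_ae (h.integrable_dotProduct hU ℓ x x) (h.integrable_dotProduct hV ℓ x x)
    ((h.ae hle ℓ).mono fun t ht => ht x)

theorem HasDensity.quad_opE_nonneg [IsMarkovKernel κ] (h : HasDensity μ κ g)
    {U : Θ → Matrix (Fin n) (Fin n) ℝ} (hU : MemHInf μ U)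
    (h0 : ∀ᵐ t ∂μ, ∀ x, 0 ≤ quad (U t) x) (ℓ : Θ) (x : Fin n → ℝ) :
    0 ≤ quad (opE μ g U ℓ) x := by
  rw [h.quad_opE hU]
  exact integral_nonneg_of_ae ((h.ae h0 ℓ).mono fun t ht => ht x)

theorem HasDensity.isSymm_opE (h : HasDensity μ κ g)
    {U : Θ → Matrix (Fin n) (Fin n) ℝ} (hU : ∀ t, (U t).IsSymm) (ℓ : Θ) :
    (opE μ g U ℓ).IsSymm := by
  ext i j
  simp only [transpose_apply, h.opE_apply, (hU _).apply i j]

theorem HasDensity.opE_const [IsMarkovKernel κ] (h : HasDensity μ κ g)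
    (M : Matrix (Fin n) (Fin n) ℝ) (ℓ : Θ) : opE μ g (fun _ => M) ℓ = M := by
  ext i j
  simp [h.opE_apply]

theorem HasDensity.opE_add [IsMarkovKernel κ] (h : HasDensity μ κ g)
    {U V : Θ → Matrix (Fin n) (Fin n) ℝ} (hU : MemHInf μ U) (hV : MemHInf μ V) (ℓ : Θ) :
    opE μ g (fun t => U t + V t) ℓ = opE μ g U ℓ + opE μ g V ℓ := by
  ext i j
  simp only [h.opE_apply, Matrix.add_apply]
  exact integral_add (h.integrable_entry hU ℓ i j) (h.integrable_entry hV ℓ i j)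

theorem HasDensity.opE_sub [IsMarkovKernel κ] (h : HasDensity μ κ g)
    {U V : Θ → Matrix (Fin n) (Fin n) ℝ} (hU : MemHInf μ U) (hV : MemHInf μ V) (ℓ : Θ) :
    opE μ g (fun t => U t - V t) ℓ = opE μ g U ℓ - opE μ g V ℓ := by
  ext i j
  simp only [h.opE_apply, Matrix.sub_apply]
  exact integral_sub (h.integrable_entry hU ℓ i j) (h.integrable_entry hV ℓ i j)

theorem HasDensity.opE_smul (h : HasDensity μ κ g)
    (U : Θ → Matrix (Fin n) (Fin n) ℝ) (r : ℝ) (ℓ : Θ) :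
    opE μ g (fun t => r • U t) ℓ = r • opE μ g U ℓ := by
  ext i j
  simp only [h.opE_apply, Matrix.smul_apply, smul_eq_mul]
  exact integral_const_mul _ _

theorem quad_opT (Q : Θ → Matrix (Fin n) (Fin a) ℝ) (U : Θ → Matrix (Fin n) (Fin n) ℝ) (ℓ : Θ)
    (x : Fin a → ℝ) : quad (opT μ g Q U ℓ) x = quad (opE μ g U ℓ) (Q ℓ *ᵥ x) :=
  quad_conj _ _ _

theorem HasDensity.memSHInf_opT [IsMarkovKernel κ] (h : HasDensity μ κ g)
    {Q : Θ → Matrix (Fin n) (Fin a) ℝ} (hQ : MemHInf μ Q)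
    {U : Θ → Matrix (Fin n) (Fin n) ℝ} (hU : MemSHInf μ U) : MemSHInf μ (opT μ g Q U) :=
  ⟨(hQ.transpose.mul (h.memHInf_opE hU.1)).mul hQ, fun ℓ => by
    simp only [opT, IsSymm, transpose_mul, transpose_transpose, (h.isSymm_opE hU.2 ℓ).eq,
      Matrix.mul_assoc]⟩

end Averaging

/-! ### Lyapunov functions -/

/-- `V ∈ 𝓗_∞^{n+}` satisfies the Lyapunov inequality `𝓣_F(V) + I ≤ V` `μ`-a.e. -/
structure IsLyapunov {Θ : Type u} [MeasurableSpace Θ] (μ : Measure Θ) (g : Θ → Θ → ℝ≥0) {n : ℕ}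
    (F V : Θ → Matrix (Fin n) (Fin n) ℝ) : Prop where
  mem : MemSHInf μ V
  nonneg : ∀ᵐ ℓ ∂μ, ∀ x, 0 ≤ quad (V ℓ) x
  decrease : ∀ᵐ ℓ ∂μ, ∀ x, quad (opE μ g V ℓ) (F ℓ *ᵥ x) + sqNorm x ≤ quad (V ℓ) x

section Lyapunov

variable {Θ : Type u} [MeasurableSpace Θ] {μ : Measure Θ} {κ : Kernel Θ Θ} {g : Θ → Θ → ℝ≥0}
  {n m p : ℕ} {F V : Θ → Matrix (Fin n) (Fin n) ℝ}

theorem IsLyapunov.sqNorm_le [IsMarkovKernel κ] (h : HasDensity μ κ g)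
    (hV : IsLyapunov μ g F V) : ∀ᵐ ℓ ∂μ, ∀ x, sqNorm x ≤ quad (V ℓ) x := by
  filter_upwards [hV.decrease] with ℓ hℓ x
  linarith [hℓ x, h.quad_opE_nonneg hV.mem.1 hV.nonneg ℓ (F ℓ *ᵥ x)]

theorem IsLyapunov.exists_contraction (hV : IsLyapunov μ g F V) : ∃ c ρ : ℝ, 1 ≤ c ∧ 0 < ρ ∧ ρ < 1 ∧
      (∀ᵐ ℓ ∂μ, ∀ x, quad (V ℓ) x ≤ c * sqNorm x) ∧
      ∀ᵐ ℓ ∂μ, ∀ x, quad (opE μ g V ℓ) (F ℓ *ᵥ x) ≤ ρ * quad (V ℓ) x := by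
  obtain ⟨r, h0, hr⟩ := hV.mem.1.exists_quad_le
  -- The decrease `‖x‖²` is at least the fraction `(r + 1)⁻¹` of `xᵀ V x`; using `r + 1` instead of
  -- `r` keeps the ratio strictly between `0` and `1`.
  refine ⟨r + 1, 1 - (r + 1)⁻¹, by linarith, ?_, ?_, ?_, ?_⟩
  · have : (r + 1)⁻¹ < 1 := inv_lt_one_of_one_lt₀ (by linarith)
    linarith
  · have : 0 < (r + 1)⁻¹ := by positivity
    linarith
  · filter_upwards [hr] with ℓ hℓ x
    nlinarith [hℓ x, sqNorm_nonneg x]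
  · filter_upwards [hr, hV.decrease] with ℓ h1 h2 x
    have h3 : (r + 1)⁻¹ * quad (V ℓ) x ≤ sqNorm x := by
      rw [inv_mul_le_iff₀ (by linarith)]
      nlinarith [h1 x, sqNorm_nonneg x]
    linarith [h2 x]

/-- If `P ≥ 0` satisfies `𝓣_Φ(P) + CᵀC + MᵀM ≤ P` with `Φ = A + G M`, and `A + H C` has a
Lyapunov function, then so has `Φ`. -/
theorem IsLyapunov.of_detectable [IsMarkovKernel κ] (h : HasDensity μ κ g)
    {A : Θ → Matrix (Fin n) (Fin n) ℝ} {G : Θ → Matrix (Fin n) (Fin m) ℝ} (hG : MemHInf μ G)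
    {C : Θ → Matrix (Fin p) (Fin n) ℝ}
    {H : Θ → Matrix (Fin n) (Fin p) ℝ} (hH : MemHInf μ H)
    (hV : IsLyapunov μ g (fun ℓ => A ℓ + H ℓ * C ℓ) V)
    {P : Θ → Matrix (Fin n) (Fin n) ℝ} (hP : MemSHInf μ P)
    (hP0 : ∀ᵐ ℓ ∂μ, ∀ x, 0 ≤ quad (P ℓ) x) {M : Θ → Matrix (Fin m) (Fin n) ℝ}
    (hPM : ∀ᵐ ℓ ∂μ, ∀ x, quad (opE μ g P ℓ) ((A ℓ + G ℓ * M ℓ) *ᵥ x)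
      + sqNorm (C ℓ *ᵥ x) + sqNorm (M ℓ *ᵥ x) ≤ quad (P ℓ) x) :
    ∃ W, IsLyapunov μ g (fun ℓ => A ℓ + G ℓ * M ℓ) W := by
  obtain ⟨c, hc, hVc⟩ := hV.mem.1.exists_quad_le
  obtain ⟨e, he, hEe⟩ := (h.memHInf_opE hV.mem.1).exists_quad_le
  obtain ⟨q, hq, hGq⟩ := hG.exists_sqNorm_le
  obtain ⟨s, hs, hHs⟩ := hH.exists_sqNorm_le
  -- With this `ε`, `ε V ≤ ‖x‖²/2`, so the cross term of Young's inequality costs only half of the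
  -- decrease of `V`.
  set ε : ℝ := (2 * c)⁻¹ with hε
  have hε0 : 0 < ε := by positivity
  -- Chosen so that `d` times the decrease of `P` pays for the perturbation `w`. The outer factor
  -- `2` in the witness turns the remaining `‖x‖²/2` back into `‖x‖²`.
  set d : ℝ := (1 + ε⁻¹) * e * (2 * (q + s)) with hd
  have hd0 : 0 < d := by positivity
  refine ⟨fun ℓ => (2 : ℝ) • (V ℓ + d • P ℓ),
    (hV.mem.add (hP.const_smul d)).const_smul 2, ?_, ?_⟩
  · filter_upwards [hV.nonneg, hP0] with ℓ h1 h2 x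
    rw [quad_smul, quad_add, quad_smul]
    have := h1 x
    have := h2 x
    positivity
  filter_upwards [hV.decrease, hVc, hEe, hGq, hHs, hPM] with ℓ h1 h2 h3 h4 h5 h6 x
  rw [h.opE_smul, h.opE_add hV.mem.1 (hP.const_smul d).1, h.opE_smul]
  simp only [quad_smul, quad_add]
  set w := G ℓ *ᵥ (M ℓ *ᵥ x) + H ℓ *ᵥ (-(C ℓ *ᵥ x)) with hw
  have hx : (A ℓ + G ℓ * M ℓ) *ᵥ x = (A ℓ + H ℓ * C ℓ) *ᵥ x + w := by
    simp only [hw, add_mulVec, mulVec_neg, mulVec_mulVec]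
    abel
  have hE := quad_add_vec_le (h.isSymm_opE hV.mem.2 ℓ)
    (fun y => h.quad_opE_nonneg hV.mem.1 hV.nonneg ℓ y) hε0 ((A ℓ + H ℓ * C ℓ) *ᵥ x) w
  rw [← hx] at hE
  have hww : sqNorm w ≤ 2 * (q + s) * (sqNorm (C ℓ *ᵥ x) + sqNorm (M ℓ *ᵥ x)) := by
    have e1 := sqNorm_add_le (G ℓ *ᵥ (M ℓ *ᵥ x)) (H ℓ *ᵥ (-(C ℓ *ᵥ x)))
    have e2 := h4 (M ℓ *ᵥ x)
    have e3 := h5 (-(C ℓ *ᵥ x))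
    have e4 : sqNorm (-(C ℓ *ᵥ x)) = sqNorm (C ℓ *ᵥ x) := by simp [sqNorm]
    rw [e4] at e3
    have e5 := mul_nonneg hq.le (sqNorm_nonneg (C ℓ *ᵥ x))
    have e6 := mul_nonneg hs.le (sqNorm_nonneg (M ℓ *ᵥ x))
    nlinarith
  have hEw : (1 + ε⁻¹) * quad (opE μ g V ℓ) w
      ≤ d * (sqNorm (C ℓ *ᵥ x) + sqNorm (M ℓ *ᵥ x)) := by
    have : quad (opE μ g V ℓ) w
        ≤ e * (2 * (q + s) * (sqNorm (C ℓ *ᵥ x) + sqNorm (M ℓ *ᵥ x))) :=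
      (h3 w).trans (mul_le_mul_of_nonneg_left hww he.le)
    calc _ ≤ (1 + ε⁻¹) * (e * (2 * (q + s) * (sqNorm (C ℓ *ᵥ x) + sqNorm (M ℓ *ᵥ x)))) :=
          mul_le_mul_of_nonneg_left this (by positivity)
      _ = _ := by rw [hd]; ring
  have hVV : (1 + ε) * quad (opE μ g V ℓ) ((A ℓ + H ℓ * C ℓ) *ᵥ x)
      ≤ quad (V ℓ) x - sqNorm x / 2 := by
    have e1 := mul_le_mul_of_nonneg_left (h1 x) (by positivity : 0 ≤ 1 + ε)
    have e2 := mul_le_mul_of_nonneg_left (h2 x) hε0.le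
    have e3 : ε * (c * sqNorm x) = sqNorm x / 2 := by
      rw [hε]; field_simp
    have e4 := mul_nonneg hε0.le (sqNorm_nonneg x)
    nlinarith
  have hPd := mul_le_mul_of_nonneg_left (h6 x) hd0.le
  nlinarith

end Lyapunov

/-! ### The Riccati operator -/

section RiccatiAlgebra

variable {n m p : ℕ}

/-- As a function of `w` the left side is quadratic with Hessian `2R`, where `R = 1 + Gᵀ E G`, and
critical point `-R⁻¹ Gᵀ E A x`. Only invertibility of `R` is used, not positivity. -/
theorem completion_of_squares {E A : Matrix (Fin n) (Fin n) ℝ} {G : Matrix (Fin n) (Fin m) ℝ}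
    (C : Matrix (Fin p) (Fin n) ℝ) (hE : E.IsSymm) (hR : IsUnit (1 + Gᵀ * E * G))
    (x : Fin n → ℝ) (w : Fin m → ℝ) :
    quad E (A *ᵥ x + G *ᵥ w) + sqNorm (C *ᵥ x) + sqNorm w =
      quad (Aᵀ * E * A + Cᵀ * C
          - (Gᵀ * E * A)ᵀ * (1 + Gᵀ * E * G)⁻¹ * (Gᵀ * E * A)) x
        + quad (1 + Gᵀ * E * G)
          (w - (-((1 + Gᵀ * E * G)⁻¹ * (Gᵀ * E * A))) *ᵥ x) := by
  set R := 1 + Gᵀ * E * G with hRd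
  have hRs : R.IsSymm := isSymm_one.add (by
    simp only [IsSymm, transpose_mul, transpose_transpose, hE.eq, Matrix.mul_assoc])
  set y := R⁻¹ *ᵥ ((Gᵀ * E * A) *ᵥ x) with hy
  have hRy : R *ᵥ y = (Gᵀ * E * A) *ᵥ x := by
    rw [hy, mulVec_mulVec, mul_nonsing_inv R ((isUnit_iff_isUnit_det R).1 hR), one_mulVec]
  have e1 : w - (-(R⁻¹ * (Gᵀ * E * A))) *ᵥ x = w + y := by
    rw [neg_mulVec, sub_neg_eq_add, hy, mulVec_mulVec]
  have e2 : w ⬝ᵥ (Gᵀ * E * A) *ᵥ x = (A *ᵥ x) ⬝ᵥ E *ᵥ (G *ᵥ w) := by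
    rw [dotProduct_mulVec_comm hE]
    simp only [← mulVec_mulVec, dotProduct_transpose_mulVec]
  have e3 : quad R w = sqNorm w + quad E (G *ᵥ w) := by
    rw [hRd, quad_add, quad_one, quad_conj]
  have e4 : quad R y = quad R⁻¹ ((Gᵀ * E * A) *ᵥ x) := by
    rw [quad, quad, hRy, dotProduct_comm]
  rw [e1, quad_add_vec hRs, quad_add_vec hE, quad_sub, quad_add, quad_conj, quad_conj, quad_gram,
    hRy, e2, e3, e4]
  ring

theorem isUnit_of_sqNorm_le_quad {R : Matrix (Fin m) (Fin m) ℝ}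
    (h : ∀ w, sqNorm w ≤ quad R w) : IsUnit R := by
  rw [← mulVec_injective_iff_isUnit]
  refine (injective_iff_map_eq_zero R.mulVecLin).2 fun w hw => ?_
  have h1 := h w
  rw [quad, show R *ᵥ w = 0 from hw, dotProduct_zero] at h1
  exact dotProduct_self_eq_zero.1 (le_antisymm h1 (sqNorm_nonneg w))

end RiccatiAlgebra

/-! ### Entrywise measurability of matrix operations, and boundedness from quadratic estimates -/

section MeasurableMatrix

variable {Θ : Type u} [MeasurableSpace Θ] {a b c : ℕ}

theorem measurable_det_of_entries {M : Θ → Matrix (Fin a) (Fin a) ℝ}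
    (hM : ∀ i j, Measurable fun ℓ => M ℓ i j) : Measurable fun ℓ => (M ℓ).det := by
  simp only [det_apply']
  exact Finset.measurable_sum _ fun σ _ =>
    (Finset.measurable_prod _ fun i _ => hM (σ i) i).const_mul _

/-- By Cramer's rule each entry is a determinant divided by `det M`. The totalized inverse is zero
where `M` is singular, so no invertibility is required. -/
theorem measurable_inv_entries {M : Θ → Matrix (Fin a) (Fin a) ℝ}
    (hM : ∀ i j, Measurable fun ℓ => M ℓ i j) (i j : Fin a) :
    Measurable fun ℓ => (M ℓ)⁻¹ i j := by
  simp only [inv_def, Matrix.smul_apply, smul_eq_mul, Ring.inverse_eq_inv', adjugate_apply]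
  refine (measurable_det_of_entries hM).inv.mul (measurable_det_of_entries fun k l => ?_)
  rcases eq_or_ne k j with rfl | hk
  · simp only [updateRow_self]
    exact measurable_const
  · simp only [updateRow_ne hk]
    exact hM k l

theorem measurable_mul_entries {M : Θ → Matrix (Fin a) (Fin b) ℝ}
    {N : Θ → Matrix (Fin b) (Fin c) ℝ}
    (hM : ∀ i j, Measurable fun ℓ => M ℓ i j) (hN : ∀ i j, Measurable fun ℓ => N ℓ i j)
    (i : Fin a) (j : Fin c) : Measurable fun ℓ => (M ℓ * N ℓ) i j := by
  simp only [mul_apply]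
  exact Finset.measurable_sum _ fun k _ => (hM i k).mul (hN k j)

theorem memHInf_of_sqNorm_mulVec_le {μ : Measure Θ} {Q : Θ → Matrix (Fin a) (Fin b) ℝ}
    (hm : ∀ i j, Measurable fun ℓ => Q ℓ i j) {r : ℝ}
    (h : ∀ᵐ ℓ ∂μ, ∀ x, sqNorm (Q ℓ *ᵥ x) ≤ r * sqNorm x) : MemHInf μ Q := by
  refine memHInf_of_entries hm (r := Real.sqrt r) (Real.sqrt_nonneg r) ?_
  filter_upwards [h] with ℓ hℓ i j
  have h1 := hℓ (Pi.single j 1)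
  rw [sqNorm_single, one_pow, mul_one] at h1
  refine Real.abs_le_sqrt (le_trans ?_ h1)
  simp only [mulVec_single_one, sqNorm, dotProduct, col_apply]
  rw [sq]
  exact Finset.single_le_sum (f := fun i => Q ℓ i j * Q ℓ i j)
    (fun k _ => mul_self_nonneg _) (Finset.mem_univ i)

end MeasurableMatrix

/-- The right-hand side of the coupled Riccati equations with `Q = CᵀC` and `R = I`. -/
noncomputable def riccati {Θ : Type u} [MeasurableSpace Θ] (μ : Measure Θ) (g : Θ → Θ → ℝ≥0)
    {n m p : ℕ} (A : Θ → Matrix (Fin n) (Fin n) ℝ) (G : Θ → Matrix (Fin n) (Fin m) ℝ)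
    (C : Θ → Matrix (Fin p) (Fin n) ℝ) (P : Θ → Matrix (Fin n) (Fin n) ℝ) (ℓ : Θ) :
    Matrix (Fin n) (Fin n) ℝ :=
  opT μ g A P ℓ + (C ℓ)ᵀ * C ℓ - (opG μ g A G P ℓ)ᵀ * (opR μ g G (fun _ => 1) P ℓ)⁻¹ *
    opG μ g A G P ℓ

section Riccati

variable {Θ : Type u} [MeasurableSpace Θ] {μ : Measure Θ} {κ : Kernel Θ Θ} {g : Θ → Θ → ℝ≥0}
  {n m p : ℕ} {A : Θ → Matrix (Fin n) (Fin n) ℝ} {G : Θ → Matrix (Fin n) (Fin m) ℝ}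
  {C : Θ → Matrix (Fin p) (Fin n) ℝ} {P P' : Θ → Matrix (Fin n) (Fin n) ℝ}

theorem HasDensity.quad_riccati (h : HasDensity μ κ g) (hP : ∀ ℓ, (P ℓ).IsSymm) {ℓ : Θ}
    (hR : IsUnit (opR μ g G (fun _ => 1) P ℓ)) (x : Fin n → ℝ) (w : Fin m → ℝ) :
    quad (opE μ g P ℓ) (A ℓ *ᵥ x + G ℓ *ᵥ w) + sqNorm (C ℓ *ᵥ x) + sqNorm w =
      quad (riccati μ g A G C P ℓ) x
        + quad (opR μ g G (fun _ => 1) P ℓ) (w - opM μ g A G (fun _ => 1) P ℓ *ᵥ x) :=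
  completion_of_squares (C ℓ) (h.isSymm_opE hP ℓ) hR x w

theorem HasDensity.quad_riccati_feedback (h : HasDensity μ κ g) (hP : ∀ ℓ, (P ℓ).IsSymm) {ℓ : Θ}
    (hR : IsUnit (opR μ g G (fun _ => 1) P ℓ)) (x : Fin n → ℝ) :
    quad (opE μ g P ℓ) ((A ℓ + G ℓ * opM μ g A G (fun _ => 1) P ℓ) *ᵥ x) + sqNorm (C ℓ *ᵥ x)
      + sqNorm (opM μ g A G (fun _ => 1) P ℓ *ᵥ x) = quad (riccati μ g A G C P ℓ) x := by
  have := h.quad_riccati (A := A) (C := C) hP hR x (opM μ g A G (fun _ => 1) P ℓ *ᵥ x)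
  rw [sub_self] at this
  rw [add_mulVec, ← mulVec_mulVec, this]
  simp [quad]

theorem HasDensity.sqNorm_le_quad_opR [IsMarkovKernel κ] (h : HasDensity μ κ g)
    (hP : MemHInf μ P) (h0 : ∀ᵐ ℓ ∂μ, ∀ x, 0 ≤ quad (P ℓ) x) (ℓ : Θ) (w : Fin m → ℝ) :
    sqNorm w ≤ quad (opR μ g G (fun _ => 1) P ℓ) w := by
  rw [opR, quad_add, quad_one, quad_opT]
  linarith [h.quad_opE_nonneg hP h0 ℓ (G ℓ *ᵥ w)]

theorem HasDensity.isUnit_opR [IsMarkovKernel κ] (h : HasDensity μ κ g)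
    (hP : MemHInf μ P) (h0 : ∀ᵐ ℓ ∂μ, ∀ x, 0 ≤ quad (P ℓ) x) (ℓ : Θ) :
    IsUnit (opR μ g G (fun _ => 1) P ℓ) :=
  isUnit_of_sqNorm_le_quad (h.sqNorm_le_quad_opR hP h0 ℓ)

theorem HasDensity.isSymm_opR (h : HasDensity μ κ g) (hP : ∀ ℓ, (P ℓ).IsSymm) (ℓ : Θ) :
    (opR μ g G (fun _ => 1) P ℓ).IsSymm :=
  isSymm_one.add (by
    simp only [opT, IsSymm, transpose_mul, transpose_transpose, (h.isSymm_opE hP ℓ).eq,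
      Matrix.mul_assoc])

theorem HasDensity.isSymm_riccati (h : HasDensity μ κ g) (hP : ∀ ℓ, (P ℓ).IsSymm) (ℓ : Θ) :
    (riccati μ g A G C P ℓ).IsSymm := by
  refine ((?_ : (opT μ g A P ℓ).IsSymm).add ?_).sub ?_
  · simp only [opT, IsSymm, transpose_mul, transpose_transpose, (h.isSymm_opE hP ℓ).eq,
      Matrix.mul_assoc]
  · simp only [IsSymm, transpose_mul, transpose_transpose]
  · simp only [IsSymm, transpose_mul, transpose_transpose, transpose_nonsing_inv,
      (h.isSymm_opR hP ℓ).eq, Matrix.mul_assoc]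

theorem HasDensity.measurable_opR_inv [IsMarkovKernel κ] (h : HasDensity μ κ g)
    (hG : MemHInf μ G) (hP : MemHInf μ P) (i j : Fin m) :
    Measurable fun ℓ => (opR μ g G (fun _ => 1) P ℓ)⁻¹ i j :=
  measurable_inv_entries (((memHInf_const 1).add
    ((hG.transpose.mul (h.memHInf_opE hP)).mul hG)).1) i j

theorem HasDensity.measurable_opM [IsMarkovKernel κ] (h : HasDensity μ κ g)
    (hA : MemHInf μ A) (hG : MemHInf μ G) (hP : MemHInf μ P) (i : Fin m) (j : Fin n) :
    Measurable fun ℓ => opM μ g A G (fun _ => 1) P ℓ i j :=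
  (measurable_mul_entries (h.measurable_opR_inv hG hP)
    ((hG.transpose.mul (h.memHInf_opE hP)).mul hA).1 i j).neg

theorem HasDensity.measurable_riccati [IsMarkovKernel κ] (h : HasDensity μ κ g)
    (hA : MemHInf μ A) (hG : MemHInf μ G) (hC : MemHInf μ C) (hP : MemHInf μ P) (i j : Fin n) :
    Measurable fun ℓ => riccati μ g A G C P ℓ i j := by
  have hΓ := (hG.transpose.mul (h.memHInf_opE hP)).mul hA
  exact ((((hA.transpose.mul (h.memHInf_opE hP)).mul hA).add (hC.transpose.mul hC)).1 i j).sub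
    (measurable_mul_entries (measurable_mul_entries hΓ.transpose.1 (h.measurable_opR_inv hG hP))
      hΓ.1 i j)

theorem HasDensity.quad_riccati_nonneg [IsMarkovKernel κ] (h : HasDensity μ κ g)
    (hP : MemSHInf μ P) (h0 : ∀ᵐ ℓ ∂μ, ∀ x, 0 ≤ quad (P ℓ) x) (ℓ : Θ) (x : Fin n → ℝ) :
    0 ≤ quad (riccati μ g A G C P ℓ) x := by
  rw [← h.quad_riccati_feedback hP.2 (h.isUnit_opR hP.1 h0 ℓ) x]
  have := h.quad_opE_nonneg hP.1 h0 ℓ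
    ((A ℓ + G ℓ * opM μ g A G (fun _ => 1) P ℓ) *ᵥ x)
  have := sqNorm_nonneg (C ℓ *ᵥ x)
  have := sqNorm_nonneg (opM μ g A G (fun _ => 1) P ℓ *ᵥ x)
  positivity

theorem HasDensity.quad_riccati_le [IsMarkovKernel κ] (h : HasDensity μ κ g)
    (hP : MemSHInf μ P) (h0 : ∀ᵐ ℓ ∂μ, ∀ x, 0 ≤ quad (P ℓ) x) (ℓ : Θ) (x : Fin n → ℝ)
    (w : Fin m → ℝ) : quad (riccati μ g A G C P ℓ) x ≤
      quad (opE μ g P ℓ) (A ℓ *ᵥ x + G ℓ *ᵥ w) + sqNorm (C ℓ *ᵥ x) + sqNorm w := by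
  rw [h.quad_riccati hP.2 (h.isUnit_opR hP.1 h0 ℓ) x w]
  linarith [h.sqNorm_le_quad_opR (G := G) hP.1 h0 ℓ
    (w - opM μ g A G (fun _ => 1) P ℓ *ᵥ x),
    sqNorm_nonneg (w - opM μ g A G (fun _ => 1) P ℓ *ᵥ x)]

/-- A minimum over `w` of expressions increasing in `P`: insert the minimizer for `P'` as a
competitor for `P`. -/
theorem HasDensity.quad_riccati_mono [IsMarkovKernel κ] (h : HasDensity μ κ g)
    (hP : MemSHInf μ P) (h0 : ∀ᵐ ℓ ∂μ, ∀ x, 0 ≤ quad (P ℓ) x) (hP' : MemSHInf μ P')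
    (hle : ∀ᵐ ℓ ∂μ, ∀ x, quad (P ℓ) x ≤ quad (P' ℓ) x) (ℓ : Θ) (x : Fin n → ℝ) :
    quad (riccati μ g A G C P ℓ) x ≤ quad (riccati μ g A G C P' ℓ) x := by
  have h0' : ∀ᵐ ℓ ∂μ, ∀ x, 0 ≤ quad (P' ℓ) x := by
    filter_upwards [h0, hle] with t h1 h2 y using (h1 y).trans (h2 y)
  rw [← h.quad_riccati_feedback hP'.2 (h.isUnit_opR hP'.1 h0' ℓ) x]
  refine (h.quad_riccati_le hP h0 ℓ x (opM μ g A G (fun _ => 1) P' ℓ *ᵥ x)).trans ?_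
  rw [add_mulVec, mulVec_mulVec]
  gcongr
  exact h.quad_opE_mono hP.1 hP'.1 hle ℓ _

/-- A bounded solution of the Riccati inequality `𝓡𝓲𝓬(S) ≤ S` for a stabilizable system. -/
theorem IsLyapunov.exists_riccati_le [IsMarkovKernel κ] (h : HasDensity μ κ g)
    (hC : MemHInf μ C) {K : Θ → Matrix (Fin m) (Fin n) ℝ} (hK : MemHInf μ K)
    {V : Θ → Matrix (Fin n) (Fin n) ℝ} (hV : IsLyapunov μ g (fun ℓ => A ℓ + G ℓ * K ℓ) V) :
    ∃ S, MemSHInf μ S ∧ (∀ᵐ ℓ ∂μ, ∀ x, 0 ≤ quad (S ℓ) x) ∧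
      ∀ᵐ ℓ ∂μ, ∀ x, quad (riccati μ g A G C S ℓ) x ≤ quad (S ℓ) x := by
  obtain ⟨r, hr, hCr⟩ := hC.exists_sqNorm_le
  obtain ⟨s, hs, hKs⟩ := hK.exists_sqNorm_le
  -- The stage cost under the gain `K` is at most `(r + s)‖x‖²`, so `(r + s) V` dominates the
  -- closed-loop cost step by step.
  have hS := hV.mem.const_smul (r + s)
  have hS0 : ∀ᵐ ℓ ∂μ, ∀ x, 0 ≤ quad ((r + s) • V ℓ) x := by
    filter_upwards [hV.nonneg] with ℓ hℓ x
    rw [quad_smul]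
    exact mul_nonneg (by positivity) (hℓ x)
  refine ⟨_, hS, hS0, ?_⟩
  filter_upwards [hCr, hKs, hV.decrease] with ℓ h1 h2 h3 x
  refine (h.quad_riccati_le hS hS0 ℓ x (K ℓ *ᵥ x)).trans ?_
  rw [h.opE_smul, quad_smul, quad_smul, mulVec_mulVec, ← add_mulVec]
  have := mul_le_mul_of_nonneg_left (h3 x) (by positivity : 0 ≤ r + s)
  linarith [h1 x, h2 x]

/-! ### Convergence of value iteration -/

open Filter Topology

theorem continuousAt_riccati_map (A D : Matrix (Fin n) (Fin n) ℝ) {G : Matrix (Fin n) (Fin m) ℝ}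
    {E₀ : Matrix (Fin n) (Fin n) ℝ} (hR : IsUnit (1 + Gᵀ * E₀ * G)) :
    ContinuousAt (fun E : Matrix (Fin n) (Fin n) ℝ => Aᵀ * E * A + D
      - (Gᵀ * E * A)ᵀ * (1 + Gᵀ * E * G)⁻¹ * (Gᵀ * E * A)) E₀ := by
  have hT : Continuous fun E : Matrix (Fin n) (Fin n) ℝ => Aᵀ * E * A + D :=
    ((continuous_const.matrix_mul continuous_id).matrix_mul continuous_const).add
      continuous_const
  have hΓ : Continuous fun E : Matrix (Fin n) (Fin n) ℝ => Gᵀ * E * A :=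
    (continuous_const.matrix_mul continuous_id).matrix_mul continuous_const
  have hR' : Continuous fun E : Matrix (Fin n) (Fin n) ℝ => 1 + Gᵀ * E * G :=
    continuous_const.add
      ((continuous_const.matrix_mul continuous_id).matrix_mul continuous_const)
  have hRi : ContinuousAt (fun E : Matrix (Fin n) (Fin n) ℝ => (1 + Gᵀ * E * G)⁻¹) E₀ := by
    refine ContinuousAt.comp (g := Inv.inv) (continuousAt_matrix_inv _ ?_) hR'.continuousAt
    rw [Ring.inverse_eq_inv']
    exact continuousAt_inv₀ ((isUnit_iff_isUnit_det _).1 hR).ne_zero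
  have hc : Continuous fun q : (Matrix (Fin n) (Fin m) ℝ × Matrix (Fin m) (Fin m) ℝ) ×
      Matrix (Fin m) (Fin n) ℝ => q.1.1 * q.1.2 * q.2 :=
    (continuous_fst.fst.matrix_mul continuous_fst.snd).matrix_mul continuous_snd
  have hp : ContinuousAt (fun E : Matrix (Fin n) (Fin n) ℝ =>
      (((Gᵀ * E * A)ᵀ, (1 + Gᵀ * E * G)⁻¹), Gᵀ * E * A)) E₀ :=
    (hΓ.matrix_transpose.continuousAt.prodMk hRi).prodMk hΓ.continuousAt
  exact hT.continuousAt.sub (ContinuousAt.comp (f := fun E : Matrix (Fin n) (Fin n) ℝ =>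
    (((Gᵀ * E * A)ᵀ, (1 + Gᵀ * E * G)⁻¹), Gᵀ * E * A)) hc.continuousAt hp)

theorem HasDensity.tendsto_opE [IsMarkovKernel κ] (h : HasDensity μ κ g)
    {U : ℕ → Θ → Matrix (Fin n) (Fin n) ℝ} (hU : ∀ k, MemHInf μ (U k)) {r : ℝ}
    (hr : ∀ k, ∀ᵐ t ∂μ, ∀ i j, |U k t i j| ≤ r)
    (hlim : ∀ᵐ t ∂μ, ∀ i j, Tendsto (fun k => U k t i j) atTop (𝓝 (P t i j))) (ℓ : Θ) :
    Tendsto (fun k => opE μ g (U k) ℓ) atTop (𝓝 (opE μ g P ℓ)) := by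
  refine tendsto_pi_nhds.2 fun i => tendsto_pi_nhds.2 fun j => ?_
  simp only [h.opE_apply]
  refine tendsto_integral_of_dominated_convergence (fun _ => r)
    (fun k => ((hU k).1 i j).aestronglyMeasurable) (integrable_const r) (fun k => ?_) ?_
  · exact (h.ae (hr k) ℓ).mono fun t ht => ht i j
  · exact (h.ae hlim ℓ).mono fun t ht => ht i j

theorem HasDensity.tendsto_riccati [IsMarkovKernel κ] (h : HasDensity μ κ g)
    {U : ℕ → Θ → Matrix (Fin n) (Fin n) ℝ} (hP : MemHInf μ P)
    (h0 : ∀ᵐ ℓ ∂μ, ∀ x, 0 ≤ quad (P ℓ) x) {ℓ : Θ}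
    (hlim : Tendsto (fun k => opE μ g (U k) ℓ) atTop (𝓝 (opE μ g P ℓ))) :
    Tendsto (fun k => riccati μ g A G C (U k) ℓ) atTop (𝓝 (riccati μ g A G C P ℓ)) := by
  exact (continuousAt_riccati_map (A ℓ) ((C ℓ)ᵀ * C ℓ) (h.isUnit_opR hP h0 ℓ)).tendsto.comp hlim

theorem tendsto_quad {M : ℕ → Matrix (Fin n) (Fin n) ℝ} {N : Matrix (Fin n) (Fin n) ℝ}
    (hM : ∀ i j, Tendsto (fun k => M k i j) atTop (𝓝 (N i j))) (x : Fin n → ℝ) :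
    Tendsto (fun k => quad (M k) x) atTop (𝓝 (quad N x)) := by
  simp only [quad, dotProduct, mulVec]
  exact tendsto_finsetSum _ fun i _ => (tendsto_finsetSum _ fun j _ =>
    (hM i j).mul_const (x j)).const_mul (x i)

/-- Value iteration converges to a nonnegative solution of the Riccati equations. -/
theorem IsLyapunov.exists_eq_riccati [IsMarkovKernel κ] (h : HasDensity μ κ g)
    (hA : MemHInf μ A) (hG : MemHInf μ G)
    (hC : MemHInf μ C) {K : Θ → Matrix (Fin m) (Fin n) ℝ} (hK : MemHInf μ K)
    {V : Θ → Matrix (Fin n) (Fin n) ℝ} (hV : IsLyapunov μ g (fun ℓ => A ℓ + G ℓ * K ℓ) V) :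
    ∃ P, MemSHInf μ P ∧ (∀ᵐ ℓ ∂μ, ∀ x, 0 ≤ quad (P ℓ) x) ∧
      ∀ᵐ ℓ ∂μ, P ℓ = riccati μ g A G C P ℓ := by
  obtain ⟨S, hS, hS0, hSr⟩ := hV.exists_riccati_le h hC hK
  obtain ⟨r, hr, hSb⟩ := hS.1.exists_quad_le
  let U : ℕ → Θ → Matrix (Fin n) (Fin n) ℝ := fun k => (riccati μ g A G C)^[k] fun _ => 0
  have hU0 : U 0 = fun _ => 0 := rfl
  have hUs : ∀ k, U (k + 1) = riccati μ g A G C (U k) := fun k =>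
    Function.iterate_succ_apply' _ _ _
  have key : ∀ k, MemSHInf μ (U k) ∧ (∀ᵐ ℓ ∂μ, ∀ x, 0 ≤ quad (U k ℓ) x) ∧
      ∀ᵐ ℓ ∂μ, ∀ x, quad (U k ℓ) x ≤ quad (S ℓ) x := by
    intro k
    induction k with
    | zero =>
      rw [hU0]
      refine ⟨⟨memHInf_const 0, fun _ => isSymm_zero⟩, ?_, ?_⟩
      · exact .of_forall fun ℓ x => by simp [quad]
      · filter_upwards [hS0] with ℓ hℓ x
        simpa [quad] using hℓ x
    | succ k ih =>
      obtain ⟨h1, h2, h3⟩ := ih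
      have h4 : ∀ᵐ ℓ ∂μ, ∀ x, 0 ≤ quad (U (k + 1) ℓ) x := by
        rw [hUs]
        exact .of_forall fun ℓ x => h.quad_riccati_nonneg h1 h2 ℓ x
      have h5 : ∀ᵐ ℓ ∂μ, ∀ x, quad (U (k + 1) ℓ) x ≤ quad (S ℓ) x := by
        rw [hUs]
        filter_upwards [hSr] with ℓ hℓ x
        exact (h.quad_riccati_mono h1 h2 hS h3 ℓ x).trans (hℓ x)
      refine ⟨memSHInf_of_quad_le ?_ ?_ h4 hr.le ?_, h4, h5⟩
      · rw [hUs]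
        exact h.measurable_riccati hA hG hC h1.1
      · rw [hUs]
        exact h.isSymm_riccati h1.2
      · filter_upwards [h5, hSb] with ℓ h6 h7 x using (h6 x).trans (h7 x)
  have hmono : ∀ k, ∀ᵐ ℓ ∂μ, ∀ x, quad (U k ℓ) x ≤ quad (U (k + 1) ℓ) x := by
    intro k
    induction k with
    | zero =>
      filter_upwards [(key 1).2.1] with ℓ hℓ x
      simpa [hU0, quad] using hℓ x
    | succ k ih =>
      refine .of_forall fun ℓ x => ?_
      rw [hUs, hUs (k + 1)]
      exact h.quad_riccati_mono (key k).1 (key k).2.1 (key (k + 1)).1 ih ℓ x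
  -- The entrywise `limsup` is defined everywhere, which gives measurability and symmetry at every
  -- point; it equals the limit off a null set.
  let P : Θ → Matrix (Fin n) (Fin n) ℝ := fun ℓ =>
    Matrix.of fun i j => limsup (fun k => U k ℓ i j) atTop
  have hPlim : ∀ᵐ ℓ ∂μ, ∀ i j, Tendsto (fun k => U k ℓ i j) atTop (𝓝 (P ℓ i j)) := by
    filter_upwards [ae_all_iff.2 hmono, ae_all_iff.2 fun k => (key k).2.2] with ℓ h1 h2 i j
    -- Monotone bounded convergence applies to quadratic forms only; polarization then transfers it
    -- to the entries, which need not be monotone.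
    have hq : ∀ x, ∃ c, Tendsto (fun k => quad (U k ℓ) x) atTop (𝓝 c) := fun x =>
      ⟨_, tendsto_atTop_ciSup (monotone_nat_of_le_succ fun k => h1 k x)
        ⟨quad (S ℓ) x, by rintro _ ⟨k, rfl⟩; exact h2 k x⟩⟩
    obtain ⟨c, hc⟩ := hq (Pi.single i 1 + Pi.single j 1)
    obtain ⟨d, hd⟩ := hq (Pi.single i 1 + -Pi.single j 1)
    have hcd : Tendsto (fun k => U k ℓ i j) atTop (𝓝 ((c - d) / 4)) := by
      refine ((hc.sub hd).div_const 4).congr fun k => ?_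
      rw [← apply_eq_quad ((key k).1.2 ℓ) i j]
      ring
    have : P ℓ i j = (c - d) / 4 := hcd.limsup_eq
    rwa [this]
  have hP0 : ∀ᵐ ℓ ∂μ, ∀ x, 0 ≤ quad (P ℓ) x := by
    filter_upwards [hPlim, ae_all_iff.2 fun k => (key k).2.1] with ℓ h1 h2 x
    exact ge_of_tendsto' (tendsto_quad h1 x) fun k => h2 k x
  have hPS : ∀ᵐ ℓ ∂μ, ∀ x, quad (P ℓ) x ≤ r * sqNorm x := by
    filter_upwards [hPlim, ae_all_iff.2 fun k => (key k).2.2, hSb] with ℓ h1 h2 h3 x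
    exact le_of_tendsto' (tendsto_quad h1 x) fun k => (h2 k x).trans (h3 x)
  have hP : MemSHInf μ P := by
    refine memSHInf_of_quad_le (fun i j => ?_) (fun ℓ => ?_) hP0 hr.le hPS
    · exact Measurable.limsup fun k => (key k).1.1.1 i j
    · ext i j
      simp only [P, transpose_apply, of_apply, ((key _).1.2 ℓ).apply i j]
  refine ⟨P, hP, hP0, ?_⟩
  have hUb : ∀ k, ∀ᵐ t ∂μ, ∀ i j, |U k t i j| ≤ r * 4 := by
    intro k
    filter_upwards [(key k).2.1, (key k).2.2, hSb] with ℓ h1 h2 h3 i j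
    exact abs_apply_le_of_quad_le ((key k).1.2 ℓ) h1 i j
      (((h2 _).trans (h3 _)).trans
        (mul_le_mul_of_nonneg_left (sqNorm_single_add_le i j).1 hr.le))
      (((h2 _).trans (h3 _)).trans
        (mul_le_mul_of_nonneg_left (sqNorm_single_add_le i j).2 hr.le))
  filter_upwards [hPlim] with ℓ hℓ
  have h1 := h.tendsto_riccati (A := A) (G := G) (C := C) hP.1 hP0
    (h.tendsto_opE (fun k => (key k).1.1) hUb hPlim ℓ)
  have h2 : Tendsto (fun k => U (k + 1) ℓ) atTop (𝓝 (P ℓ)) :=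
    (tendsto_add_atTop_iff_nat (f := fun k => U k ℓ) 1).2
      (tendsto_pi_nhds.2 fun i => tendsto_pi_nhds.2 fun j => hℓ i j)
  simp only [hUs] at h2
  exact tendsto_nhds_unique h2 h1

end Riccati

/-! ### One-step transitions of a Markov chain -/

/-- An input space of dimension zero lets the results on controlled trajectories cover the free
ones. -/
theorem freeState_eq_state {Θ : Type u} {Ω : Type v} {n : ℕ} (A : Θ → Matrix (Fin n) (Fin n) ℝ) (θ : ℕ → Ω → Θ)
    (x₀ : Fin n → ℝ) (k : ℕ) : freeState A θ x₀ k =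
      state A (fun _ => (0 : Matrix (Fin n) (Fin 0) ℝ)) θ (fun _ _ => 0) x₀ k := by
  induction k with
  | zero => rfl
  | succ k ih =>
    funext ω
    simp [freeState, state, ih]

theorem measurable_quad {X : Type*} {mX : MeasurableSpace X} {n : ℕ}
    {M : X → Matrix (Fin n) (Fin n) ℝ} {y : X → Fin n → ℝ}
    (hM : ∀ i j, Measurable fun x => M x i j) (hy : Measurable y) :
    Measurable fun x => quad (M x) (y x) := by
  have hy' := measurable_pi_iff.1 hy
  simp only [quad, dotProduct, mulVec]
  exact Finset.measurable_sum _ fun i _ => (hy' i).mul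
    (Finset.measurable_sum _ fun j _ => (hM i j).mul (hy' j))

theorem measurable_mulVec {X : Type*} {mX : MeasurableSpace X} {a b : ℕ}
    {M : X → Matrix (Fin a) (Fin b) ℝ} {y : X → Fin b → ℝ}
    (hM : ∀ i j, Measurable fun x => M x i j) (hy : Measurable y) :
    Measurable fun x => M x *ᵥ y x := by
  have hy' := measurable_pi_iff.1 hy
  refine measurable_pi_iff.2 fun i => ?_
  simp only [dotProduct, mulVec]
  exact Finset.measurable_sum _ fun j _ => (hM i j).mul (hy' j)

section Chain

variable {Θ : Type u} [MeasurableSpace Θ] {κ : Kernel Θ Θ} {Ω : Type v} {θ : ℕ → Ω → Θ}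

theorem measurable_history (k : ℕ) {i : ℕ} (hi : i ≤ k) : Measurable[history θ k] (θ i) :=
  (comap_measurable (θ i)).mono (le_iSup₂_of_le i hi le_rfl) le_rfl

theorem history_mono {j k : ℕ} (hjk : j ≤ k) : history θ j ≤ history θ k :=
  iSup₂_le fun i hi => le_iSup₂_of_le i (hi.trans hjk) le_rfl

variable {n m : ℕ} {A : Θ → Matrix (Fin n) (Fin n) ℝ} {G : Θ → Matrix (Fin n) (Fin m) ℝ}
  {w : ℕ → Ω → Fin m → ℝ}

theorem measurable_next_state (hA : ∀ i j, Measurable fun ℓ => A ℓ i j)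
    (hG : ∀ i j, Measurable fun ℓ => G ℓ i j) {k : ℕ} {x : Ω → Fin n → ℝ} {y : Ω → Fin m → ℝ}
    (hx : Measurable[history θ k] x) (hy : Measurable[history θ k] y) :
    Measurable[history θ k] fun ω => A (θ k ω) *ᵥ x ω + G (θ k ω) *ᵥ y ω := by
  have hθ := measurable_history (θ := θ) k le_rfl
  have h1 : Measurable[history θ k] fun ω => A (θ k ω) *ᵥ x ω :=
    @measurable_mulVec _ (history θ k) _ _ _ _ (fun i j => (hA i j).comp hθ) hx
  have h2 : Measurable[history θ k] fun ω => G (θ k ω) *ᵥ y ω :=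
    @measurable_mulVec _ (history θ k) _ _ _ _ (fun i j => (hG i j).comp hθ) hy
  exact h1.add h2

theorem measurable_state (hA : ∀ i j, Measurable fun ℓ => A ℓ i j)
    (hG : ∀ i j, Measurable fun ℓ => G ℓ i j) (hw : ∀ k, Measurable[history θ k] (w k))
    (x₀ : Fin n → ℝ) : ∀ k, Measurable[history θ k] (state A G θ w x₀ k)
  | 0 => measurable_const
  | k + 1 => (measurable_next_state hA hG (measurable_state hA hG hw x₀ k) (hw k)).mono
      (history_mono k.le_succ) le_rfl

variable [MeasurableSpace Ω] {Pr : Measure Ω}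

theorem history_le (hθ : ∀ k, Measurable (θ k)) (k : ℕ) :
    history θ k ≤ (inferInstance : MeasurableSpace Ω) :=
  iSup₂_le fun i _ => (hθ i).comap_le

theorem IsMarkovChain.measure_inter [IsMarkovKernel κ] [IsProbabilityMeasure Pr]
    (hθ : IsMarkovChain κ Pr θ) (k : ℕ) {s : Set Ω} (hs : MeasurableSet[history θ k] s)
    {Λ : Set Θ} (hΛ : MeasurableSet Λ) :
    Pr (s ∩ θ (k + 1) ⁻¹' Λ) = ∫⁻ ω in s, κ (θ k ω) Λ ∂Pr := by
  have hm := history_le hθ.measurable k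
  have hΛ' : MeasurableSet (θ (k + 1) ⁻¹' Λ) := hθ.measurable _ hΛ
  have h1 := setIntegral_condExp (μ := Pr) hm
    (f := (θ (k + 1) ⁻¹' Λ).indicator fun _ => (1 : ℝ))
    ((integrable_const 1).indicator hΛ') hs
  rw [setIntegral_congr_ae (hm _ hs) ((hθ.transition k Λ hΛ).mono fun ω hω _ => hω),
    setIntegral_indicator hΛ', setIntegral_const, smul_eq_mul, mul_one] at h1
  simp only [Measure.real] at h1
  have hκm : Measurable fun ω => κ (θ k ω) Λ := (κ.measurable_coe hΛ).comp (hθ.measurable k)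
  rw [integral_toReal hκm.aemeasurable
    (.of_forall fun ω => measure_lt_top _ _)] at h1
  refine ((ENNReal.toReal_eq_toReal_iff' ?_ (measure_ne_top _ _)).1 h1).symm
  refine ne_of_lt (lt_of_le_of_lt (lintegral_mono fun ω => prob_le_one) ?_)
  simp [measure_lt_top]

/-- The Markov property identifies the joint law of `(z, θ(k+1))` on measurable rectangles, and
these determine a probability measure on the product. -/
theorem IsMarkovChain.lintegral_succ [IsMarkovKernel κ] [IsProbabilityMeasure Pr]
    (hθ : IsMarkovChain κ Pr θ) (k : ℕ) {Z : Type*} [MeasurableSpace Z] {z : Ω → Z}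
    (hz : Measurable[history θ k] z) {F : Z × Θ → ℝ≥0∞} (hF : Measurable F) :
    ∫⁻ ω, F (z ω, θ (k + 1) ω) ∂Pr = ∫⁻ ω, ∫⁻ t, F (z ω, t) ∂κ (θ k ω) ∂Pr := by
  have hm := history_le hθ.measurable k
  have hz' : Measurable z := hz.mono hm le_rfl
  have hp : Measurable fun q : Ω × Θ => (z q.1, q.2) :=
    (hz'.comp measurable_fst).prodMk measurable_snd
  have key : Pr.map (fun ω => (z ω, θ (k + 1) ω)) =
      (Pr ⊗ₘ κ.comap (θ k) (hθ.measurable k)).map fun q => (z q.1, q.2) := by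
    have : IsProbabilityMeasure (Pr.map fun ω => (z ω, θ (k + 1) ω)) :=
      Measure.isProbabilityMeasure_map (hz'.prodMk (hθ.measurable _)).aemeasurable
    refine Measure.ext_prod fun {s t} hs ht => ?_
    rw [Measure.map_apply (hz'.prodMk (hθ.measurable _)) (hs.prod ht),
      Measure.map_apply hp (hs.prod ht)]
    have e1 : (fun ω => (z ω, θ (k + 1) ω)) ⁻¹' s ×ˢ t = z ⁻¹' s ∩ θ (k + 1) ⁻¹' t := rfl
    have e2 : (fun q : Ω × Θ => (z q.1, q.2)) ⁻¹' s ×ˢ t = (z ⁻¹' s) ×ˢ t := rfl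
    rw [e1, e2, Measure.compProd_apply_prod (hz' hs) ht, hθ.measure_inter k (hz hs) ht]
    rfl
  rw [← lintegral_map hF (hz'.prodMk (hθ.measurable _)), key, lintegral_map hF hp]
  exact Measure.lintegral_compProd (hF.comp hp)

/-- The law of every `θ(k)` is absolutely continuous: by assumption at time `0`, and afterwards
because every `κ ℓ` has a density. Thus almost everywhere statements can be evaluated along the
chain. -/
theorem IsMarkovChain.ae [IsMarkovKernel κ] [IsProbabilityMeasure Pr] {μ : Measure Θ}
    {g : Θ → Θ → ℝ≥0} (hθ : IsMarkovChain κ Pr θ) (h : HasDensity μ κ g)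
    (h0 : Pr.map (θ 0) ≪ μ) {q : Θ → Prop} (hq : ∀ᵐ t ∂μ, q t) (k : ℕ) :
    ∀ᵐ ω ∂Pr, q (θ k ω) := by
  cases k with
  | zero => exact ae_of_ae_map (hθ.measurable 0).aemeasurable (h0.ae_le hq)
  | succ k =>
    obtain ⟨N, hN, hNm, hN0⟩ := exists_measurable_superset_of_null hq
    have h1 := hθ.measure_inter k (s := Set.univ) MeasurableSet.univ hNm
    simp only [h.absolutelyContinuous _ hN0, lintegral_zero, Set.univ_inter] at h1
    exact measure_mono_null (fun ω hω => hN hω) h1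

theorem IsMarkovChain.lintegral_quad_succ [IsMarkovKernel κ] [IsProbabilityMeasure Pr]
    {μ : Measure Θ} {g : Θ → Θ → ℝ≥0} (hθ : IsMarkovChain κ Pr θ) (h : HasDensity μ κ g)
    {n : ℕ} {U : Θ → Matrix (Fin n) (Fin n) ℝ} (hU : MemHInf μ U)
    (hU0 : ∀ᵐ ℓ ∂μ, ∀ x, 0 ≤ quad (U ℓ) x) (k : ℕ) {y : Ω → Fin n → ℝ}
    (hy : Measurable[history θ k] y) :
    ∫⁻ ω, ENNReal.ofReal (quad (U (θ (k + 1) ω)) (y ω)) ∂Pr =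
      ∫⁻ ω, ENNReal.ofReal (quad (opE μ g U (θ k ω)) (y ω)) ∂Pr := by
  have hF : Measurable fun q : (Fin n → ℝ) × Θ => ENNReal.ofReal (quad (U q.2) q.1) :=
    (measurable_quad (fun i j => (hU.1 i j).comp measurable_snd) measurable_fst).ennreal_ofReal
  rw [hθ.lintegral_succ k hy hF]
  refine lintegral_congr fun ω => ?_
  rw [h.quad_opE hU]
  exact (ofReal_integral_eq_lintegral_ofReal (h.integrable_dotProduct hU _ _ _)
    ((h.ae hU0 _).mono fun t ht => ht _)).symm

/-- The weighted second moment `𝐄[x(k)ᵀ U(ϑ(k)) x(k)]`. -/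
noncomputable def weightedSq (Pr : Measure Ω) (θ : ℕ → Ω → Θ) (U : Θ → Matrix (Fin n) (Fin n) ℝ)
    (x : ℕ → Ω → Fin n → ℝ) (k : ℕ) : ℝ≥0∞ :=
  ∫⁻ ω, ENNReal.ofReal (quad (U (θ k ω)) (x k ω)) ∂Pr

theorem IsMarkovChain.weightedSq_succ [IsMarkovKernel κ] [IsProbabilityMeasure Pr]
    {μ : Measure Θ} {g : Θ → Θ → ℝ≥0} (hθ : IsMarkovChain κ Pr θ) (h : HasDensity μ κ g)
    (hA : ∀ i j, Measurable fun ℓ => A ℓ i j)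
    (hG : ∀ i j, Measurable fun ℓ => G ℓ i j) (hw : ∀ k, Measurable[history θ k] (w k))
    {U : Θ → Matrix (Fin n) (Fin n) ℝ} (hU : MemHInf μ U)
    (hU0 : ∀ᵐ ℓ ∂μ, ∀ x, 0 ≤ quad (U ℓ) x) (x₀ : Fin n → ℝ) (k : ℕ) :
    weightedSq Pr θ U (state A G θ w x₀) (k + 1) =
      ∫⁻ ω, ENNReal.ofReal (quad (opE μ g U (θ k ω))
        (A (θ k ω) *ᵥ state A G θ w x₀ k ω + G (θ k ω) *ᵥ w k ω)) ∂Pr :=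
  hθ.lintegral_quad_succ h hU hU0 k
    (measurable_next_state hA hG (measurable_state hA hG hw x₀ k) (hw k))

theorem IsMarkovChain.weightedSq_freeState_succ [IsMarkovKernel κ] [IsProbabilityMeasure Pr]
    {μ : Measure Θ} {g : Θ → Θ → ℝ≥0} (hθ : IsMarkovChain κ Pr θ) (h : HasDensity μ κ g)
    (hA : ∀ i j, Measurable fun ℓ => A ℓ i j)
    {U : Θ → Matrix (Fin n) (Fin n) ℝ} (hU : MemHInf μ U)
    (hU0 : ∀ᵐ ℓ ∂μ, ∀ x, 0 ≤ quad (U ℓ) x) (x₀ : Fin n → ℝ) (k : ℕ) :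
    weightedSq Pr θ U (freeState A θ x₀) (k + 1) =
      weightedSq Pr θ (opT μ g A U) (freeState A θ x₀) k := by
  have h1 := hθ.weightedSq_succ h hA (G := fun _ => (0 : Matrix (Fin n) (Fin 0) ℝ))
    (w := fun _ _ => 0) (fun _ _ => measurable_const) (fun _ => measurable_const) hU hU0 x₀ k
  have e : state A (fun _ => (0 : Matrix (Fin n) (Fin 0) ℝ)) θ (fun _ _ => 0) x₀
      = freeState A θ x₀ := funext fun k => (freeState_eq_state A θ x₀ k).symm
  rw [e] at h1
  rw [h1]
  simp only [zero_mulVec, add_zero, weightedSq, quad_opT]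

end Chain

/-! ### Exponential mean-square stability and Lyapunov functions -/

section Stability

variable {Θ : Type u} [MeasurableSpace Θ] {μ : Measure Θ} {κ : Kernel Θ Θ} [IsMarkovKernel κ]
  {g : Θ → Θ → ℝ≥0} {n : ℕ} {F V : Θ → Matrix (Fin n) (Fin n) ℝ}

/-- `𝐄[xᵀ V x]` contracts by `ρ` at each step and lies between `𝐄‖x‖²` and `c 𝐄‖x‖²`. The sample
space has an arbitrary universe here, as the control problem demands, whereas `EMSS` uses that of
`Θ`. -/
theorem IsLyapunov.exists_meanSq_le (h : HasDensity μ κ g) (hF : MemHInf μ F)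
    (hV : IsLyapunov μ g F V) : ∃ β α : ℝ, 1 ≤ β ∧ 0 < α ∧ α < 1 ∧
      ∀ (Ω : Type v) [MeasurableSpace Ω] (Pr : Measure Ω) [IsProbabilityMeasure Pr]
        (θ : ℕ → Ω → Θ), IsMarkovChain κ Pr θ → Pr.map (θ 0) ≪ μ →
        ∀ (x₀ : Fin n → ℝ) (k : ℕ),
          meanSq Pr (freeState F θ x₀ k) ≤ ENNReal.ofReal (β * α ^ k * sqNorm x₀) := by
  obtain ⟨c, ρ, hc, hρ0, hρ1, hVc, hVρ⟩ := hV.exists_contraction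
  refine ⟨c, ρ, hc, hρ0, hρ1, fun Ω _ Pr _ θ hθ h0 x₀ k => ?_⟩
  have h1 : meanSq Pr (freeState F θ x₀ k) ≤ weightedSq Pr θ V (freeState F θ x₀) k := by
    refine lintegral_mono_ae ?_
    filter_upwards [hθ.ae h h0 (hV.sqNorm_le h) k] with ω hω
    exact ENNReal.ofReal_le_ofReal (hω _)
  have h2 : ∀ k, weightedSq Pr θ V (freeState F θ x₀) k
      ≤ ENNReal.ofReal (c * ρ ^ k * sqNorm x₀) := by
    intro k
    induction k with
    | zero =>
      calc weightedSq Pr θ V (freeState F θ x₀) 0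
          ≤ ∫⁻ _, ENNReal.ofReal (c * sqNorm x₀) ∂Pr := by
            refine lintegral_mono_ae ?_
            filter_upwards [hθ.ae h h0 hVc 0] with ω hω
            exact ENNReal.ofReal_le_ofReal (hω _)
        _ = _ := by simp
    | succ k ih =>
      rw [hθ.weightedSq_freeState_succ h hF.1 hV.mem.1 hV.nonneg]
      calc weightedSq Pr θ (opT μ g F V) (freeState F θ x₀) k
          ≤ ∫⁻ ω, ENNReal.ofReal ρ * ENNReal.ofReal
              (quad (V (θ k ω)) (freeState F θ x₀ k ω)) ∂Pr := by
            refine lintegral_mono_ae ?_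
            filter_upwards [hθ.ae h h0 hVρ k] with ω hω
            rw [← ENNReal.ofReal_mul hρ0.le, quad_opT]
            exact ENNReal.ofReal_le_ofReal (hω _)
        _ = ENNReal.ofReal ρ * weightedSq Pr θ V (freeState F θ x₀) k :=
            lintegral_const_mul' _ _ ENNReal.ofReal_ne_top
        _ ≤ ENNReal.ofReal ρ * ENNReal.ofReal (c * ρ ^ k * sqNorm x₀) := by gcongr
        _ = _ := by
            rw [← ENNReal.ofReal_mul hρ0.le]
            congr 1
            ring
  exact h1.trans (h2 k)

theorem IsLyapunov.emss (h : HasDensity μ κ g) (hF : MemHInf μ F)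
    (hV : IsLyapunov μ g F V) : EMSS μ κ F :=
  hV.exists_meanSq_le h hF

/-- The canonical Markov chain on the path space with a given initial law. -/
theorem exists_isMarkovChain (κ : Kernel Θ Θ) [IsMarkovKernel κ] (ν : Measure Θ)
    [IsProbabilityMeasure ν] : ∃ Pr : Measure (ℕ → Θ), IsProbabilityMeasure Pr ∧
      IsMarkovChain κ Pr (fun k ω => ω k) ∧ Pr.map (fun ω => ω 0) = ν := by
  -- The trajectory construction takes kernels depending on the whole past; here only the last
  -- coordinate enters.
  let η : (k : ℕ) → Kernel ((i : Finset.Iic k) → Θ) Θ := fun k =>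
    κ.comap (fun y => y ⟨k, Finset.mem_Iic.2 le_rfl⟩) (measurable_pi_apply _)
  let Pr : Measure (ℕ → Θ) := Kernel.trajMeasure (X := fun _ => Θ) ν η
  have hPr : IsProbabilityMeasure Pr := by dsimp only [Pr]; infer_instance
  refine ⟨Pr, hPr, ⟨fun k => measurable_pi_apply k, fun k Λ hΛ => ?_⟩, ?_⟩
  · have hmeas : ∀ k, Measurable fun ω : ℕ → Θ => ω k := fun k => measurable_pi_apply k
    have hm := history_le (θ := fun k (ω : ℕ → Θ) => ω k) hmeas k
    have hκm : Measurable fun t => (κ t).real Λ := (κ.measurable_coe hΛ).ennreal_toReal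
    have hΛ' : MeasurableSet ((fun ω : ℕ → Θ => ω (k + 1)) ⁻¹' Λ) := hmeas _ hΛ
    refine (ae_eq_condExp_of_forall_setIntegral_eq hm
      ((integrable_const (1 : ℝ)).indicator hΛ') (fun s _ _ => ?_) (fun s hs _ => ?_) ?_).symm
    · refine Integrable.integrableOn (Integrable.of_bound
        (hκm.comp (hmeas k)).aestronglyMeasurable 1 (.of_forall fun ω => ?_))
      rw [Real.norm_of_nonneg measureReal_nonneg]
      exact measureReal_le_one
    · have hle : history (fun k (ω : ℕ → Θ) => ω k) k ≤
          MeasurableSpace.comap (Preorder.frestrictLe (π := fun _ => Θ) k) inferInstance := by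
        refine iSup₂_le fun i hi => ?_
        rintro _ ⟨t, ht, rfl⟩
        exact ⟨(fun y => y ⟨i, Finset.mem_Iic.2 hi⟩) ⁻¹' t, measurable_pi_apply _ ht, rfl⟩
      obtain ⟨S, hS, rfl⟩ := hle _ hs
      have h1 := congrArg (fun M => M (S ×ˢ Λ))
        (Kernel.map_frestrictLe_trajMeasure_compProd_eq_map_trajMeasure (X := fun _ => Θ)
          (κ := η) (μ₀ := ν) (a := k))
      have hfr : Measurable (Preorder.frestrictLe (π := fun _ => Θ) k) :=
        Preorder.measurable_frestrictLe k
      simp only [Measure.compProd_apply_prod hS hΛ] at h1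
      rw [Measure.map_apply (hfr.prodMk (hmeas _)) (hS.prod hΛ),
        setLIntegral_map hS ((η k).measurable_coe hΛ) hfr] at h1
      rw [setIntegral_indicator hΛ', setIntegral_const, smul_eq_mul, mul_one]
      simp only [Measure.real]
      have hκk : Measurable fun ω : ℕ → Θ => κ (ω k) Λ := (κ.measurable_coe hΛ).comp (hmeas k)
      rw [integral_toReal hκk.aemeasurable
        (.of_forall fun ω => measure_lt_top _ _)]
      exact congrArg ENNReal.toReal h1
    · exact (hκm.comp (measurable_history (θ := fun k (ω : ℕ → Θ) => ω k) k
        le_rfl)).aestronglyMeasurable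
  · have hev : Measurable fun y : (i : Finset.Iic 0) → Θ => y ⟨0, Finset.mem_Iic.2 le_rfl⟩ :=
      measurable_pi_apply _
    have hfr : Measurable (Preorder.frestrictLe (π := fun _ => Θ) 0) :=
      Preorder.measurable_frestrictLe 0
    have e : (fun ω : ℕ → Θ => ω 0) = (fun y : (i : Finset.Iic 0) → Θ =>
        y ⟨0, Finset.mem_Iic.2 le_rfl⟩) ∘ Preorder.frestrictLe (π := fun _ => Θ) 0 := rfl
    have e2 : Pr.map (Preorder.frestrictLe (π := fun _ => Θ) 0) =
        ν.map (MeasurableEquiv.piUnique (fun _ : Finset.Iic 0 => Θ)).symm := by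
      dsimp only [Pr, Kernel.trajMeasure]
      rw [Measure.map_comp _ _ hfr, Kernel.traj_map_frestrictLe, Kernel.partialTraj_self]
      exact Measure.id_comp
    rw [e, ← Measure.map_map hev hfr, e2, Measure.map_map hev (MeasurableEquiv.measurable _)]
    exact Measure.map_id

end Stability

/-! ### From mean-square stability to a Lyapunov function -/

section Converse

variable {Θ : Type u} [MeasurableSpace Θ] {μ : Measure Θ} {κ : Kernel Θ Θ} [IsMarkovKernel κ]
  {g : Θ → Θ → ℝ≥0} {n : ℕ} {F U : Θ → Matrix (Fin n) (Fin n) ℝ}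

theorem HasDensity.quad_opT_nonneg (h : HasDensity μ κ g) (hU : MemHInf μ U)
    (hU0 : ∀ᵐ ℓ ∂μ, ∀ x, 0 ≤ quad (U ℓ) x) (ℓ : Θ) (x : Fin n → ℝ) :
    0 ≤ quad (opT μ g F U ℓ) x := by
  rw [quad_opT]
  exact h.quad_opE_nonneg hU hU0 ℓ _

theorem HasDensity.opT_iterate (h : HasDensity μ κ g) (hF : MemHInf μ F) (hU : MemSHInf μ U)
    (hU0 : ∀ᵐ ℓ ∂μ, ∀ x, 0 ≤ quad (U ℓ) x) (k : ℕ) :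
    MemSHInf μ ((opT μ g F)^[k] U) ∧ ∀ᵐ ℓ ∂μ, ∀ x, 0 ≤ quad ((opT μ g F)^[k] U ℓ) x := by
  induction k with
  | zero => exact ⟨hU, hU0⟩
  | succ k ih =>
    rw [Function.iterate_succ_apply']
    exact ⟨h.memSHInf_opT hF ih.1, .of_forall fun ℓ x => h.quad_opT_nonneg ih.1.1 ih.2 ℓ x⟩

/-- Each step back in time trades one factor of the dynamics for one application of `𝓣_F` to the
weight; hence the induction varies `U`. -/
theorem IsMarkovChain.weightedSq_freeState {Ω : Type v} [MeasurableSpace Ω] {Pr : Measure Ω}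
    [IsProbabilityMeasure Pr] {θ : ℕ → Ω → Θ} (hθ : IsMarkovChain κ Pr θ)
    (h : HasDensity μ κ g) (hF : MemHInf μ F) (hU : MemSHInf μ U)
    (hU0 : ∀ᵐ ℓ ∂μ, ∀ x, 0 ≤ quad (U ℓ) x) (x₀ : Fin n → ℝ) (k : ℕ) :
    weightedSq Pr θ U (freeState F θ x₀) k =
      ∫⁻ ω, ENNReal.ofReal (quad ((opT μ g F)^[k] U (θ 0 ω)) x₀) ∂Pr := by
  induction k generalizing U with
  | zero => rfl
  | succ k ih =>
    rw [hθ.weightedSq_freeState_succ h hF.1 hU.1 hU0, ih (h.memSHInf_opT hF hU)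
      (.of_forall fun ℓ x => h.quad_opT_nonneg hU.1 hU0 ℓ x)]
    rfl

/-- Mean-square bounds for all chains bound the iterates `𝓣_F^k(I)` `μ`-a.e. -/
theorem ae_quad_iterate_le [SigmaFinite μ] (h : HasDensity μ κ g) (hF : MemHInf μ F) {b : ℝ}
    {x₀ : Fin n → ℝ} {k : ℕ}
    (hb : ∀ (Ω : Type u) [MeasurableSpace Ω] (Pr : Measure Ω) [IsProbabilityMeasure Pr]
      (θ : ℕ → Ω → Θ), IsMarkovChain κ Pr θ → Pr.map (θ 0) ≪ μ →
        meanSq Pr (freeState F θ x₀ k) ≤ ENNReal.ofReal b) (hb0 : 0 ≤ b) :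
    ∀ᵐ ℓ ∂μ, quad ((opT μ g F)^[k] (fun _ => 1) ℓ) x₀ ≤ b := by
  have hone : ∀ᵐ ℓ ∂μ, ∀ x, 0 ≤ quad ((fun _ : Θ => (1 : Matrix (Fin n) (Fin n) ℝ)) ℓ) x :=
    .of_forall fun ℓ x => by rw [quad_one]; exact sqNorm_nonneg x
  have hit := h.opT_iterate hF memSHInf_one hone k
  have hmeas : Measurable fun ℓ =>
      ENNReal.ofReal (quad ((opT μ g F)^[k] (fun _ => 1) ℓ) x₀) :=
    (measurable_quad hit.1.1.1 measurable_const).ennreal_ofReal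
  have key : (fun ℓ => ENNReal.ofReal (quad ((opT μ g F)^[k] (fun _ => 1) ℓ) x₀))
      ≤ᵐ[μ] fun _ => ENNReal.ofReal b := by
    refine ae_le_of_forall_setLIntegral_le_of_sigmaFinite hmeas fun s hs hsf => ?_
    rcases eq_or_ne (μ s) 0 with h0 | h0
    · rw [setLIntegral_measure_zero _ _ h0]
      exact zero_le
    -- Starting the chain from `μ` conditioned on `s` turns the moment bound into a bound on the
    -- integral over `s`. As `s` is an arbitrary measurable set of finite measure, the pointwise
    -- bound follows.
    have hν : IsProbabilityMeasure (ProbabilityTheory.cond μ s) :=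
      cond_isProbabilityMeasure_of_finite h0 hsf.ne
    obtain ⟨Pr, hPr, hθ, hlaw⟩ := exists_isMarkovChain κ (ProbabilityTheory.cond μ s)
    have h1 := hb _ Pr _ hθ (hlaw ▸ cond_absolutelyContinuous)
    have h2 := hθ.weightedSq_freeState h hF memSHInf_one hone x₀ k
    have h3 : weightedSq Pr (fun k ω => ω k) (fun _ => 1)
        (freeState F (fun k (ω : ℕ → Θ) => ω k) x₀) k
        = meanSq Pr (freeState F (fun k (ω : ℕ → Θ) => ω k) x₀ k) := by
      simp only [weightedSq, quad_one, meanSq]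
    rw [← h3, h2, ← lintegral_map hmeas (measurable_pi_apply 0), hlaw,
      ProbabilityTheory.cond, lintegral_smul_measure, smul_eq_mul,
      ENNReal.inv_mul_le_iff h0 hsf.ne] at h1
    rw [setLIntegral_const, mul_comm]
    exact h1
  exact key.mono fun ℓ hℓ => (ENNReal.ofReal_le_ofReal_iff hb0).1 hℓ

/-- The null set in `ae_quad_iterate_le` depends on `x₀`. Using only the finitely many polarization
vectors, of squared norm at most `4`, yields one null set for all `x`. -/
theorem EMSS.exists_quad_iterate_le [SigmaFinite μ] (h : HasDensity μ κ g) (hF : MemHInf μ F)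
    (hE : EMSS μ κ F) : ∃ c α : ℝ, 0 ≤ c ∧ 0 < α ∧ α < 1 ∧ ∀ k, ∀ᵐ ℓ ∂μ, ∀ x,
      quad ((opT μ g F)^[k] (fun _ => 1) ℓ) x ≤ c * α ^ k * sqNorm x := by
  obtain ⟨β, α, hβ, hα0, hα1, hb⟩ := hE
  obtain ⟨K, hK0, hK⟩ := exists_norm_le_mul n n
  refine ⟨K * (β * 4), α, by positivity, hα0, hα1, fun k => ?_⟩
  have hone : ∀ᵐ ℓ ∂μ, ∀ x, 0 ≤ quad ((fun _ : Θ => (1 : Matrix (Fin n) (Fin n) ℝ)) ℓ) x :=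
    .of_forall fun ℓ x => by rw [quad_one]; exact sqNorm_nonneg x
  have hit := h.opT_iterate hF memSHInf_one hone k
  have hq : ∀ x₀ : Fin n → ℝ, sqNorm x₀ ≤ 4 →
      ∀ᵐ ℓ ∂μ, quad ((opT μ g F)^[k] (fun _ => 1) ℓ) x₀ ≤ β * α ^ k * 4 := by
    intro x₀ hx₀
    refine ae_quad_iterate_le h hF (fun Ω _ Pr _ θ hθ h0 => ?_) (by positivity)
    refine (hb Ω Pr θ hθ h0 x₀ k).trans (ENNReal.ofReal_le_ofReal ?_)
    exact mul_le_mul_of_nonneg_left hx₀ (by positivity)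
  have h1 := ae_all_iff.2 fun i => ae_all_iff.2 fun j =>
    hq (Pi.single i 1 + Pi.single j 1) (sqNorm_single_add_le i j).1
  have h2 := ae_all_iff.2 fun i => ae_all_iff.2 fun j =>
    hq (Pi.single i 1 + -Pi.single j 1) (sqNorm_single_add_le i j).2
  filter_upwards [h1, h2, hit.2] with ℓ h1 h2 h3 x
  have h4 := hK _ (β * α ^ k * 4) (by positivity) fun i j =>
    abs_apply_le_of_quad_le (hit.1.2 ℓ) h3 i j (h1 i j) (h2 i j)
  refine (le_abs_self _).trans ((abs_quad_le _ _).trans ?_)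
  refine mul_le_mul_of_nonneg_right (h4.trans_eq ?_) (sqNorm_nonneg x)
  ring

/-- Take `V = ∑_{k<N} 𝓣_F^k(I)`; applying `𝓣_F` shifts the sum by one. -/
theorem HasDensity.exists_sum_iterate (h : HasDensity μ κ g) (hF : MemHInf μ F) (N : ℕ) :
    ∃ V, MemSHInf μ V ∧ (∀ᵐ ℓ ∂μ, ∀ x, 0 ≤ quad (V ℓ) x) ∧ ∀ ℓ x,
      quad (opT μ g F V ℓ) x + sqNorm x =
        quad (V ℓ) x + quad ((opT μ g F)^[N] (fun _ => 1) ℓ) x := by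
  have hone : ∀ᵐ ℓ ∂μ, ∀ x, 0 ≤ quad ((fun _ : Θ => (1 : Matrix (Fin n) (Fin n) ℝ)) ℓ) x :=
    .of_forall fun ℓ x => by rw [quad_one]; exact sqNorm_nonneg x
  induction N with
  | zero =>
    refine ⟨fun _ => 0, ⟨memHInf_const 0, fun _ => isSymm_zero⟩,
      .of_forall fun ℓ x => by simp [quad], fun ℓ x => ?_⟩
    rw [quad_opT, h.opE_const, Function.iterate_zero, id, quad_one]
    simp [quad]
  | succ N ih =>
    obtain ⟨V, hV, hV0, hVe⟩ := ih
    obtain ⟨hT, hT0⟩ := h.opT_iterate hF memSHInf_one hone N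
    refine ⟨_, hV.add hT, ?_, fun ℓ x => ?_⟩
    · filter_upwards [hV0, hT0] with ℓ h1 h2 x
      rw [quad_add]
      exact add_nonneg (h1 x) (h2 x)
    · have h1 := hVe ℓ x
      rw [quad_opT] at h1
      rw [Function.iterate_succ_apply', quad_opT, quad_opT, h.opE_add hV.1 hT.1, quad_add,
        quad_add]
      linarith

theorem EMSS.exists_isLyapunov [SigmaFinite μ] (h : HasDensity μ κ g) (hF : MemHInf μ F)
    (hE : EMSS μ κ F) : ∃ V, IsLyapunov μ g F V := by
  obtain ⟨c, α, hc, hα0, hα1, hk⟩ := hE.exists_quad_iterate_le h hF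
  -- Once `𝓣_F^N(I) ≤ I/2`, the truncated sum already decreases by `‖x‖²/2`, and doubling it
  -- suffices; no infinite series is needed.
  obtain ⟨N, hN⟩ := exists_pow_lt_of_lt_one (show 0 < (2 * (c + 1))⁻¹ by positivity) hα1
  have hN' : c * α ^ N ≤ 1 / 2 := by
    calc c * α ^ N ≤ (c + 1) * (2 * (c + 1))⁻¹ :=
          mul_le_mul (by linarith) hN.le (by positivity) (by positivity)
      _ = 1 / 2 := by field_simp
  obtain ⟨V, hV, hV0, hVe⟩ := h.exists_sum_iterate hF N
  refine ⟨fun ℓ => (2 : ℝ) • V ℓ, hV.const_smul 2, ?_, ?_⟩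
  · filter_upwards [hV0] with ℓ hℓ x
    rw [quad_smul]
    linarith [hℓ x]
  · filter_upwards [hk N] with ℓ hℓ x
    have h1 := hVe ℓ x
    rw [quad_opT] at h1
    rw [h.opE_smul, quad_smul, quad_smul]
    linarith [hℓ x, mul_le_mul_of_nonneg_right hN' (sqNorm_nonneg x)]

end Converse

/-! ### Uniqueness of the stabilizing solution -/

section Uniqueness

variable {n m : ℕ}

/-- Both follow from `R M = -Gᵀ E A`. The second is the stationarity condition for the optimal gain.
-/
theorem closed_loop_identities {E A Q P : Matrix (Fin n) (Fin n) ℝ}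
    {G : Matrix (Fin n) (Fin m) ℝ} {R : Matrix (Fin m) (Fin m) ℝ} {M : Matrix (Fin m) (Fin n) ℝ}
    (hE : E.IsSymm) (hR : R = 1 + Gᵀ * E * G) (hu : IsUnit R)
    (hM : M = -(R⁻¹ * (Gᵀ * E * A)))
    (hP : P = Aᵀ * E * A + Q - (Gᵀ * E * A)ᵀ * R⁻¹ * (Gᵀ * E * A)) :
    P = Aᵀ * E * (A + G * M) + Q ∧ Gᵀ * E * (A + G * M) = -M := by
  have hRM : R * M = -(Gᵀ * E * A) := by
    rw [hM, Matrix.mul_neg, ← Matrix.mul_assoc, mul_nonsing_inv R ((isUnit_iff_isUnit_det R).1 hu),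
      Matrix.one_mul]
  constructor
  · have e1 : (Gᵀ * E * A)ᵀ = Aᵀ * E * G := by
      simp only [transpose_mul, transpose_transpose, hE.eq, Matrix.mul_assoc]
    rw [hP, e1, Matrix.mul_assoc (Aᵀ * E * G), ← neg_neg (R⁻¹ * (Gᵀ * E * A)), ← hM,
      Matrix.mul_add, Matrix.mul_neg, ← Matrix.mul_assoc (Aᵀ * E) G M]
    abel
  · have e2 : Gᵀ * E * (G * M) = R * M - M := by
      rw [hR, Matrix.add_mul, Matrix.one_mul, ← Matrix.mul_assoc]
      abel
    rw [Matrix.mul_add, e2, hRM]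
    abel

/-- By stationarity, changing the gain in the left factor alters the mixed product only by `-Nᵀ M`.
The two mixed products thus share the term `M₁ᵀ M₂`, which cancels. -/
theorem sub_eq_closed_loop {E₁ E₂ A Q P₁ P₂ : Matrix (Fin n) (Fin n) ℝ}
    {G : Matrix (Fin n) (Fin m) ℝ} {M₁ M₂ : Matrix (Fin m) (Fin n) ℝ}
    (hE₁ : E₁.IsSymm) (hP₁s : P₁.IsSymm) (hQ : Q.IsSymm)
    (h₁ : P₁ = Aᵀ * E₁ * (A + G * M₁) + Q) (h₁' : Gᵀ * E₁ * (A + G * M₁) = -M₁)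
    (h₂ : P₂ = Aᵀ * E₂ * (A + G * M₂) + Q) (h₂' : Gᵀ * E₂ * (A + G * M₂) = -M₂) :
    P₁ - P₂ = (A + G * M₁)ᵀ * (E₁ - E₂) * (A + G * M₂) := by
  have key : ∀ {E P : Matrix (Fin n) (Fin n) ℝ} {M N : Matrix (Fin m) (Fin n) ℝ},
      P = Aᵀ * E * (A + G * M) + Q → Gᵀ * E * (A + G * M) = -M →
      (A + G * N)ᵀ * E * (A + G * M) = P - Q - Nᵀ * M := by
    intro E P M N h h'
    have e1 : (A + G * N)ᵀ * E * (A + G * M)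
        = Aᵀ * E * (A + G * M) + Nᵀ * (Gᵀ * E * (A + G * M)) := by
      rw [transpose_add, transpose_mul, Matrix.add_mul, Matrix.add_mul]
      simp only [Matrix.mul_assoc]
    rw [e1, h', h, Matrix.mul_neg]
    abel
  have k2 := key (N := M₁) h₂ h₂'
  have k1 := congrArg transpose (key (N := M₂) h₁ h₁')
  simp only [transpose_sub, transpose_mul, transpose_transpose, hE₁.eq, hP₁s.eq, hQ.eq] at k1
  rw [Matrix.mul_sub, Matrix.sub_mul, k2, Matrix.mul_assoc, k1]
  abel

variable {Θ : Type u} [MeasurableSpace Θ] {μ : Measure Θ} {κ : Kernel Θ Θ} [IsMarkovKernel κ]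
  {g : Θ → Θ → ℝ≥0}

open Filter Topology in
/-- A fixed point of `D ↦ Φ₁ᵀ 𝓔(D) Φ₂` vanishes if `Φ₁` and `Φ₂` are mean-square stable. -/
theorem ae_eq_zero_of_fixed_point [SigmaFinite μ] (h : HasDensity μ κ g)
    {Φ₁ Φ₂ D : Θ → Matrix (Fin n) (Fin n) ℝ} (hΦ₁ : MemHInf μ Φ₁) (hΦ₂ : MemHInf μ Φ₂)
    (hE₁ : EMSS μ κ Φ₁) (hE₂ : EMSS μ κ Φ₂) (hD : MemSHInf μ D)
    (hfix : ∀ᵐ ℓ ∂μ, D ℓ = (Φ₁ ℓ)ᵀ * opE μ g D ℓ * Φ₂ ℓ) : ∀ᵐ ℓ ∂μ, D ℓ = 0 := by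
  obtain ⟨r, hr0, hr⟩ := hD.1.exists_pos
  obtain ⟨c₁, α₁, -, hα₁, hα₁', hk₁⟩ := hE₁.exists_quad_iterate_le h hΦ₁
  obtain ⟨c₂, α₂, -, hα₂, hα₂', hk₂⟩ := hE₂.exists_quad_iterate_le h hΦ₂
  have hone : ∀ᵐ ℓ ∂μ, ∀ x, 0 ≤ quad ((fun _ : Θ => (1 : Matrix (Fin n) (Fin n) ℝ)) ℓ) x :=
    .of_forall fun ℓ x => by rw [quad_one]; exact sqNorm_nonneg x
  -- `D` is indefinite and the two factors differ, so the bilinear form is bounded by separate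
  -- quadratic forms in `x` and `y`; the fixed-point equation propagates this bound to the next
  -- iterates. Polarization gives the base case with room to spare.
  have key : ∀ k, ∀ᵐ ℓ ∂μ, ∀ x y, x ⬝ᵥ D ℓ *ᵥ y ≤ 2 * r *
      (quad ((opT μ g Φ₁)^[k] (fun _ => 1) ℓ) x + quad ((opT μ g Φ₂)^[k] (fun _ => 1) ℓ) y) := by
    intro k
    induction k with
    | zero =>
      filter_upwards [hr] with ℓ hℓ x y
      simp only [Function.iterate_zero, id, quad_one]
      have hb : ∀ z, |quad (D ℓ) z| ≤ r * sqNorm z := fun z => (abs_quad_le _ _).trans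
        (mul_le_mul_of_nonneg_right hℓ (sqNorm_nonneg z))
      have h1 := quad_add_vec (hD.2 ℓ) x y
      have h2 := (abs_le.1 (hb (x + y))).2
      have h3 := (abs_le.1 (hb x)).1
      have h4 := (abs_le.1 (hb y)).1
      have h5 := mul_le_mul_of_nonneg_left (sqNorm_add_le x y) hr0.le
      have h6 := mul_nonneg hr0.le (sqNorm_nonneg x)
      have h7 := mul_nonneg hr0.le (sqNorm_nonneg y)
      nlinarith
    | succ k ih =>
      have i₁ := h.opT_iterate hΦ₁ memSHInf_one hone k
      have i₂ := h.opT_iterate hΦ₂ memSHInf_one hone k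
      filter_upwards [hfix] with ℓ hℓ x y
      rw [Function.iterate_succ_apply', Function.iterate_succ_apply', quad_opT, quad_opT,
        h.quad_opE i₁.1.1, h.quad_opE i₂.1.1,
        ← integral_add (h.integrable_quad i₁.1.1 _ _)
          (h.integrable_quad i₂.1.1 _ _), ← integral_const_mul, hℓ,
        ← mulVec_mulVec, ← mulVec_mulVec, dotProduct_transpose_mulVec,
        h.dotProduct_opE_mulVec hD.1]
      refine integral_mono_ae (h.integrable_dotProduct hD.1 _ _ _)
        (((h.integrable_quad i₁.1.1 _ _).add
          (h.integrable_quad i₂.1.1 _ _)).const_mul _) ?_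
      exact (h.ae ih ℓ).mono fun t ht => ht _ _
  filter_upwards [ae_all_iff.2 key, ae_all_iff.2 hk₁, ae_all_iff.2 hk₂] with ℓ h1 h2 h3
  have hle : ∀ x y, x ⬝ᵥ D ℓ *ᵥ y ≤ 0 := by
    intro x y
    have l₁ := tendsto_pow_atTop_nhds_zero_of_lt_one hα₁.le hα₁'
    have l₂ := tendsto_pow_atTop_nhds_zero_of_lt_one hα₂.le hα₂'
    have l := ((((l₁.const_mul c₁).mul_const (sqNorm x)).add
      ((l₂.const_mul c₂).mul_const (sqNorm y))).const_mul (2 * r))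
    simp only [mul_zero, zero_mul, add_zero] at l
    refine ge_of_tendsto' l fun k => (h1 k x y).trans ?_
    exact mul_le_mul_of_nonneg_left (add_le_add (h2 k x) (h3 k y)) (by positivity)
  refine eq_of_forall_dotProduct_mulVec_eq fun x y => ?_
  -- The upper bound holds for all `x`, so replacing `x` by `-x` gives the lower one.
  have h4 := hle (-x) y
  rw [neg_dotProduct] at h4
  rw [zero_mulVec, dotProduct_zero]
  linarith [hle x y]

theorem IsStabilizingSolution.ae_eq [SigmaFinite μ] (h : HasDensity μ κ g)
    {A : Θ → Matrix (Fin n) (Fin n) ℝ} (hA : MemHInf μ A)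
    {G : Θ → Matrix (Fin n) (Fin m) ℝ} (hG : MemHInf μ G)
    {Q P₁ P₂ : Θ → Matrix (Fin n) (Fin n) ℝ} (hQ : ∀ ℓ, (Q ℓ).IsSymm)
    (h₁ : IsStabilizingSolution μ κ g A G Q (fun _ => 1) P₁)
    (h₂ : IsStabilizingSolution μ κ g A G Q (fun _ => 1) P₂) : P₁ =ᵐ[μ] P₂ := by
  obtain ⟨⟨hP₁, hu₁, he₁⟩, hM₁, hs₁⟩ := h₁
  obtain ⟨⟨hP₂, hu₂, he₂⟩, hM₂, hs₂⟩ := h₂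
  have := ae_eq_zero_of_fixed_point h (hA.add (hG.mul hM₁)) (hA.add (hG.mul hM₂)) hs₁ hs₂
    (hP₁.sub hP₂) (by
      filter_upwards [hu₁, hu₂, he₁, he₂] with ℓ a₁ a₂ b₁ b₂
      rw [h.opE_sub hP₁.1 hP₂.1]
      obtain ⟨c₁, d₁⟩ := closed_loop_identities (h.isSymm_opE hP₁.2 ℓ) rfl a₁ rfl b₁
      obtain ⟨c₂, d₂⟩ := closed_loop_identities (h.isSymm_opE hP₂.2 ℓ) rfl a₂ rfl b₂
      exact sub_eq_closed_loop (h.isSymm_opE hP₁.2 ℓ) (hP₁.2 ℓ) (hQ ℓ) c₁ d₁ c₂ d₂)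
  exact this.mono fun ℓ hℓ => sub_eq_zero.1 hℓ

end Uniqueness

/-! ### The linear-quadratic problem -/

theorem state_feedback {Θ : Type u} {Ω : Type v} {n m : ℕ} (A : Θ → Matrix (Fin n) (Fin n) ℝ)
    (G : Θ → Matrix (Fin n) (Fin m) ℝ) (K : Θ → Matrix (Fin m) (Fin n) ℝ) (θ : ℕ → Ω → Θ)
    (x₀ : Fin n → ℝ) (k : ℕ) :
    state A G θ (fun k ω => K (θ k ω) *ᵥ freeState (fun ℓ => A ℓ + G ℓ * K ℓ) θ x₀ k ω) x₀ k
      = freeState (fun ℓ => A ℓ + G ℓ * K ℓ) θ x₀ k := by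
  induction k with
  | zero => rfl
  | succ k ih =>
    funext ω
    simp only [state, freeState, ih, add_mulVec, mulVec_mulVec]

/-- The stage cost `𝐄[‖C(ϑ(k)) x(k)‖² + ‖u(k)‖²]`. -/
noncomputable def stageCost {Θ : Type u} {Ω : Type v} [MeasurableSpace Ω] {n m p : ℕ}
    (Pr : Measure Ω) (C : Θ → Matrix (Fin p) (Fin n) ℝ)
    (θ : ℕ → Ω → Θ) (x : ℕ → Ω → Fin n → ℝ) (w : ℕ → Ω → Fin m → ℝ) (k : ℕ) : ℝ≥0∞ :=
  ∫⁻ ω, ENNReal.ofReal (sqNorm (C (θ k ω) *ᵥ x k ω) + sqNorm (w k ω)) ∂Pr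

theorem lqCost_eq_tsum_stageCost {Θ : Type u} {Ω : Type v} [MeasurableSpace Ω] {n m p : ℕ}
    (Pr : Measure Ω) (A : Θ → Matrix (Fin n) (Fin n) ℝ) (G : Θ → Matrix (Fin n) (Fin m) ℝ)
    (C : Θ → Matrix (Fin p) (Fin n) ℝ) (θ : ℕ → Ω → Θ) (x₀ : Fin n → ℝ)
    (w : ℕ → Ω → Fin m → ℝ) :
    lqCost Pr A G C θ x₀ w = ∑' k, stageCost Pr C θ (state A G θ w x₀) w k := by
  simp only [lqCost, stageCost, ← quad_gram]
  rfl

section LQ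

variable {Θ : Type u} [MeasurableSpace Θ] {μ : Measure Θ} {κ : Kernel Θ Θ} [IsMarkovKernel κ]
  {g : Θ → Θ → ℝ≥0} {n m p : ℕ} {A : Θ → Matrix (Fin n) (Fin n) ℝ}
  {G : Θ → Matrix (Fin n) (Fin m) ℝ} {C : Θ → Matrix (Fin p) (Fin n) ℝ}
  {P : Θ → Matrix (Fin n) (Fin n) ℝ}
  {Ω : Type v} [MeasurableSpace Ω] {Pr : Measure Ω} [IsProbabilityMeasure Pr] {θ : ℕ → Ω → Θ}
  {w : ℕ → Ω → Fin m → ℝ} {x₀ : Fin n → ℝ}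

theorem measurable_sqNorm {X : Type*} [MeasurableSpace X] {a : ℕ} {y : X → Fin a → ℝ}
    (hy : Measurable y) : Measurable fun x => sqNorm (y x) := by
  simp only [← quad_one]
  exact measurable_quad (fun _ _ => measurable_const) hy

/-- One-step dissipation identity along a controlled trajectory. -/
theorem IsMarkovChain.stageCost_add_weightedSq (hθ : IsMarkovChain κ Pr θ)
    (h : HasDensity μ κ g) (h0 : Pr.map (θ 0) ≪ μ) (hA : MemHInf μ A) (hG : MemHInf μ G)
    (hC : MemHInf μ C) (hP : MemSHInf μ P) (hP0 : ∀ᵐ ℓ ∂μ, ∀ x, 0 ≤ quad (P ℓ) x)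
    (hPr : ∀ᵐ ℓ ∂μ, P ℓ = riccati μ g A G C P ℓ)
    (hw : ∀ k, Measurable[history θ k] (w k)) (k : ℕ) :
    stageCost Pr C θ (state A G θ w x₀) w k + weightedSq Pr θ P (state A G θ w x₀) (k + 1) =
      weightedSq Pr θ P (state A G θ w x₀) k
        + ∫⁻ ω, ENNReal.ofReal (quad (opR μ g G (fun _ => 1) P (θ k ω))
          (w k ω - opM μ g A G (fun _ => 1) P (θ k ω) *ᵥ state A G θ w x₀ k ω)) ∂Pr := by
  have hm := history_le hθ.measurable k
  have hx : Measurable (state A G θ w x₀ k) :=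
    (measurable_state hA.1 hG.1 hw x₀ k).mono hm le_rfl
  have hwk : Measurable (w k) := (hw k).mono hm le_rfl
  have hθk := hθ.measurable k
  rw [hθ.weightedSq_succ h hA.1 hG.1 hw hP.1 hP0, stageCost, weightedSq,
    ← lintegral_add_left, ← lintegral_add_left]
  · refine lintegral_congr_ae ?_
    filter_upwards [hθ.ae h h0 hPr k, hθ.ae h h0 hP0 k] with ω h1 h2
    rw [← ENNReal.ofReal_add (add_nonneg (sqNorm_nonneg _) (sqNorm_nonneg _))
      (h.quad_opE_nonneg hP.1 hP0 _ _), ← ENNReal.ofReal_add (h2 _)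
      ((sqNorm_nonneg _).trans (h.sqNorm_le_quad_opR hP.1 hP0 _ _)), h1,
      ← h.quad_riccati hP.2 (h.isUnit_opR hP.1 hP0 _)]
    congr 1
    ring
  · exact (measurable_quad (fun i j => (hP.1.1 i j).comp hθk) hx).ennreal_ofReal
  · exact ((measurable_sqNorm (measurable_mulVec (fun i j => (hC.1 i j).comp hθk) hx)).add
      (measurable_sqNorm hwk)).ennreal_ofReal

theorem weightedSq_zero (hθ : IsMarkovChain κ Pr θ) (h : HasDensity μ κ g)
    (h0 : Pr.map (θ 0) ≪ μ) (hP : MemHInf μ P) (hP0 : ∀ᵐ ℓ ∂μ, ∀ x, 0 ≤ quad (P ℓ) x) :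
    weightedSq Pr θ P (state A G θ w x₀) 0 =
      ENNReal.ofReal (x₀ ⬝ᵥ meanInit Pr θ P *ᵥ x₀) := by
  have hi : ∀ i j, Integrable (fun ω => P (θ 0 ω) i j) Pr := by
    intro i j
    obtain ⟨r, hr⟩ := hP.2
    exact Integrable.of_bound ((hP.1 i j).comp (hθ.measurable 0)).aestronglyMeasurable r
      ((hθ.ae h h0 hr 0).mono fun ω hω => (abs_apply_le_norm _ i j).trans hω)
  rw [meanInit, dotProduct_integral_mulVec hi, ofReal_integral_eq_lintegral_ofReal
    (integrable_dotProduct_mulVec hi _ _) ((hθ.ae h h0 hP0 0).mono fun ω hω => hω _)]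
  rfl

open Filter Topology in
theorem IsMarkovChain.tendsto_weightedSq (hθ : IsMarkovChain κ Pr θ) (h : HasDensity μ κ g)
    (h0 : Pr.map (θ 0) ≪ μ) (hP : MemHInf μ P)
    (hw : w ∈ admissible Pr A G θ x₀) :
    Tendsto (weightedSq Pr θ P (state A G θ w x₀)) atTop (𝓝 0) := by
  obtain ⟨r, hr0, hr⟩ := hP.exists_quad_le
  obtain ⟨-, -, β, α, -, hα0, hα1, hb⟩ := hw
  have hle : ∀ k, weightedSq Pr θ P (state A G θ w x₀) k
      ≤ ENNReal.ofReal (r * (β * α ^ k * sqNorm x₀)) := by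
    intro k
    calc weightedSq Pr θ P (state A G θ w x₀) k
        ≤ ∫⁻ ω, ENNReal.ofReal r * ENNReal.ofReal (sqNorm (state A G θ w x₀ k ω)) ∂Pr := by
          refine lintegral_mono_ae ?_
          filter_upwards [hθ.ae h h0 hr k] with ω hω
          rw [← ENNReal.ofReal_mul hr0.le]
          exact ENNReal.ofReal_le_ofReal (hω _)
      _ = ENNReal.ofReal r * meanSq Pr (state A G θ w x₀ k) :=
          lintegral_const_mul' _ _ ENNReal.ofReal_ne_top
      _ ≤ ENNReal.ofReal r * ENNReal.ofReal (β * α ^ k * sqNorm x₀) := by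
          gcongr
          exact hb k
      _ = _ := (ENNReal.ofReal_mul hr0.le).symm
  have hlim : Tendsto (fun k => ENNReal.ofReal (r * (β * α ^ k * sqNorm x₀))) atTop (𝓝 0) := by
    have := (((tendsto_pow_atTop_nhds_zero_of_lt_one hα0.le hα1).const_mul β).mul_const
      (sqNorm x₀)).const_mul r
    simp only [mul_zero, zero_mul] at this
    simpa using ENNReal.tendsto_ofReal this
  exact tendsto_of_tendsto_of_tendsto_of_le_of_le tendsto_const_nhds hlim
    (fun _ => zero_le) hle

/-- Dropping the nonnegative squares leaves initial value ≤ partial cost + terminal value, and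
exponential stability of the state removes the terminal value in the limit. No subtraction in `[0,
∞]` occurs. -/
theorem le_lqCost (hθ : IsMarkovChain κ Pr θ)
    (h : HasDensity μ κ g) (h0 : Pr.map (θ 0) ≪ μ) (hA : MemHInf μ A) (hG : MemHInf μ G)
    (hC : MemHInf μ C) (hP : MemSHInf μ P) (hP0 : ∀ᵐ ℓ ∂μ, ∀ x, 0 ≤ quad (P ℓ) x)
    (hPr : ∀ᵐ ℓ ∂μ, P ℓ = riccati μ g A G C P ℓ) (hw : w ∈ admissible Pr A G θ x₀) :
    ENNReal.ofReal (x₀ ⬝ᵥ meanInit Pr θ P *ᵥ x₀) ≤ lqCost Pr A G C θ x₀ w := by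
  rw [← weightedSq_zero (A := A) (G := G) (w := w) hθ h h0 hP.1 hP0, lqCost_eq_tsum_stageCost]
  have hstep : ∀ N, weightedSq Pr θ P (state A G θ w x₀) 0 ≤
      ∑ k ∈ Finset.range N, stageCost Pr C θ (state A G θ w x₀) w k
        + weightedSq Pr θ P (state A G θ w x₀) N := by
    intro N
    induction N with
    | zero => simp
    | succ N ih =>
      rw [Finset.sum_range_succ, add_assoc,
        hθ.stageCost_add_weightedSq h h0 hA hG hC hP hP0 hPr hw.1 N, ← add_assoc]
      exact ih.trans le_self_add
  have hlim := (hθ.tendsto_weightedSq h h0 hP.1 hw).const_add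
    (∑' k, stageCost Pr C θ (state A G θ w x₀) w k)
  rw [add_zero] at hlim
  exact ge_of_tendsto' hlim fun N =>
    (hstep N).trans (by gcongr; exact ENNReal.sum_le_tsum _)

/-- The squares vanish and the terminal value is nonnegative. Admissibility is not assumed: this
bound is what later proves the feedback square summable. -/
theorem lqCost_le_of_feedback (hθ : IsMarkovChain κ Pr θ)
    (h : HasDensity μ κ g) (h0 : Pr.map (θ 0) ≪ μ) (hA : MemHInf μ A) (hG : MemHInf μ G)
    (hC : MemHInf μ C) (hP : MemSHInf μ P) (hP0 : ∀ᵐ ℓ ∂μ, ∀ x, 0 ≤ quad (P ℓ) x)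
    (hPr : ∀ᵐ ℓ ∂μ, P ℓ = riccati μ g A G C P ℓ)
    (hw : ∀ k, Measurable[history θ k] (w k))
    (hfb : ∀ k ω, w k ω = opM μ g A G (fun _ => 1) P (θ k ω) *ᵥ state A G θ w x₀ k ω) :
    lqCost Pr A G C θ x₀ w ≤ ENNReal.ofReal (x₀ ⬝ᵥ meanInit Pr θ P *ᵥ x₀) := by
  rw [← weightedSq_zero (A := A) (G := G) (w := w) hθ h h0 hP.1 hP0, lqCost_eq_tsum_stageCost]
  have hstep : ∀ N, ∑ k ∈ Finset.range N, stageCost Pr C θ (state A G θ w x₀) w k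
        + weightedSq Pr θ P (state A G θ w x₀) N
      = weightedSq Pr θ P (state A G θ w x₀) 0 := by
    intro N
    induction N with
    | zero => simp
    | succ N ih =>
      rw [Finset.sum_range_succ, add_assoc,
        hθ.stageCost_add_weightedSq h h0 hA hG hC hP hP0 hPr hw N, ← add_assoc, ih]
      simp [← hfb, quad]
  exact ENNReal.tsum_le_of_sum_range_le fun N => le_self_add.trans_eq (hstep N)

end LQ

end MJLS

theorem corollary3 {Θ : Type u} [MeasurableSpace Θ] [StandardBorelSpace Θ]
    (μ : Measure Θ) [SigmaFinite μ]
    (κ : Kernel Θ Θ) [IsMarkovKernel κ]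
    (g : Θ → Θ → ℝ≥0) (hg : ∀ ℓ, Measurable (g ℓ))
    (hκ : ∀ ℓ, κ ℓ = μ.withDensity (fun t => (g ℓ t : ℝ≥0∞)))
    {n m p : ℕ}
    (A : Θ → Matrix (Fin n) (Fin n) ℝ) (hA : MJLS.MemHInf μ A)
    (G : Θ → Matrix (Fin n) (Fin m) ℝ) (hG : MJLS.MemHInf μ G)
    (C : Θ → Matrix (Fin p) (Fin n) ℝ) (hC : MJLS.MemHInf μ C)
    (hstab : MJLS.IsStabilizable μ κ A G)
    (hdet : MJLS.IsDetectable μ κ A C) :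
    ∃ P : Θ → Matrix (Fin n) (Fin n) ℝ,
      MJLS.MemHInfPos μ P ∧
      MJLS.IsStabilizingSolution μ κ g A G (fun ℓ => (C ℓ)ᵀ * C ℓ) (fun _ => 1) P ∧
      MJLS.UnifPos μ (MJLS.opR μ g G (fun _ => 1) P) ∧
      (∀ P' : Θ → Matrix (Fin n) (Fin n) ℝ,
        MJLS.IsStabilizingSolution μ κ g A G (fun ℓ => (C ℓ)ᵀ * C ℓ) (fun _ => 1) P' →
          P' =ᵐ[μ] P) ∧
      ∀ (Ω : Type v) [MeasurableSpace Ω] (Pr : Measure Ω) [IsProbabilityMeasure Pr]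
        (θ : ℕ → Ω → Θ), MJLS.IsMarkovChain κ Pr θ → Pr.map (θ 0) ≪ μ →
        ∀ x₀ : Fin n → ℝ,
          IsGLB (MJLS.lqCost Pr A G C θ x₀ '' MJLS.admissible Pr A G θ x₀)
            (ENNReal.ofReal (x₀ ⬝ᵥ MJLS.meanInit Pr θ P *ᵥ x₀)) ∧
          ∃ u ∈ MJLS.admissible Pr A G θ x₀,
            (∀ k ω, u k ω =
              MJLS.opM μ g A G (fun _ => 1) P (θ k ω) *ᵥ MJLS.state A G θ u x₀ k ω) ∧
            MJLS.lqCost Pr A G C θ x₀ u =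
              ENNReal.ofReal (x₀ ⬝ᵥ MJLS.meanInit Pr θ P *ᵥ x₀) := by
  have h : MJLS.HasDensity μ κ g := ⟨hg, hκ⟩
  obtain ⟨K, hK, hKs⟩ := hstab
  obtain ⟨H, hH, hHs⟩ := hdet
  obtain ⟨S, hS⟩ := hKs.exists_isLyapunov h (hA.add (hG.mul hK))
  obtain ⟨V, hV⟩ := hHs.exists_isLyapunov h (hA.add (hH.mul hC))
  obtain ⟨P, hP, hP0, hPr⟩ := hS.exists_eq_riccati h hA hG hC hK
  have hPM : ∀ᵐ ℓ ∂μ, ∀ x, MJLS.quad (MJLS.opE μ g P ℓ)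
      ((A ℓ + G ℓ * MJLS.opM μ g A G (fun _ => 1) P ℓ) *ᵥ x) + MJLS.sqNorm (C ℓ *ᵥ x)
        + MJLS.sqNorm (MJLS.opM μ g A G (fun _ => 1) P ℓ *ᵥ x) = MJLS.quad (P ℓ) x := by
    filter_upwards [hPr] with ℓ hℓ x
    rw [h.quad_riccati_feedback hP.2 (h.isUnit_opR hP.1 hP0 ℓ) x, ← hℓ]
  have hM : MJLS.MemHInf μ (MJLS.opM μ g A G (fun _ => 1) P) := by
    -- The Riccati equation itself bounds the gain: `‖𝓜(P) x‖² ≤ xᵀ P x ≤ r‖x‖²`.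
    obtain ⟨r, -, hr⟩ := hP.1.exists_quad_le
    refine MJLS.memHInf_of_sqNorm_mulVec_le (h.measurable_opM hA hG hP.1) (r := r) ?_
    filter_upwards [hPM, hr] with ℓ h1 h2 x
    linarith [h1 x, h2 x, MJLS.sqNorm_nonneg (C ℓ *ᵥ x), h.quad_opE_nonneg hP.1 hP0 ℓ
      ((A ℓ + G ℓ * MJLS.opM μ g A G (fun _ => 1) P ℓ) *ᵥ x)]
  obtain ⟨W, hW⟩ := hV.of_detectable h hG hH hP hP0 (hPM.mono fun ℓ hℓ x => (hℓ x).le)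
  have hΦ := hA.add (hG.mul hM)
  have hPs : MJLS.IsStabilizingSolution μ κ g A G (fun ℓ => (C ℓ)ᵀ * C ℓ) (fun _ => 1) P :=
    ⟨⟨hP, .of_forall fun ℓ => h.isUnit_opR hP.1 hP0 ℓ, hPr⟩, hM, hW.emss h hΦ⟩
  refine ⟨P, ⟨hP, hP0.mono fun ℓ hℓ => (MJLS.posSemidef_iff_quad (hP.2 ℓ)).2 hℓ⟩, hPs,
    ⟨1, one_pos, .of_forall fun ℓ => ?_⟩, fun P' hP' => ?_, fun Ω _ Pr _ θ hθ h0 x₀ => ?_⟩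
  · refine (MJLS.posSemidef_iff_quad ((h.isSymm_opR hP.2 ℓ).sub
      (isSymm_one.smul (1 : ℝ)))).2 fun w => ?_
    rw [MJLS.quad_sub, MJLS.quad_smul, MJLS.quad_one, one_mul, sub_nonneg]
    exact h.sqNorm_le_quad_opR hP.1 hP0 ℓ w
  · exact hP'.ae_eq h hA hG
      (fun ℓ => by simp only [IsSymm, transpose_mul, transpose_transpose]) hPs
  · let w : ℕ → Ω → Fin m → ℝ := fun k ω => MJLS.opM μ g A G (fun _ => 1) P (θ k ω) *ᵥ
      MJLS.freeState (fun ℓ => A ℓ + G ℓ * MJLS.opM μ g A G (fun _ => 1) P ℓ) θ x₀ k ω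
    have hx : ∀ k, MJLS.state A G θ w x₀ k = MJLS.freeState
        (fun ℓ => A ℓ + G ℓ * MJLS.opM μ g A G (fun _ => 1) P ℓ) θ x₀ k :=
      MJLS.state_feedback _ _ _ _ _
    have hfb : ∀ k ω, w k ω =
        MJLS.opM μ g A G (fun _ => 1) P (θ k ω) *ᵥ MJLS.state A G θ w x₀ k ω := by
      intro k ω
      rw [hx k]
    have hwm : ∀ k, Measurable[MJLS.history θ k] (w k) := by
      intro k
      refine @MJLS.measurable_mulVec _ (MJLS.history θ k) _ _ _ _
        (fun i j => (hM.1 i j).comp (MJLS.measurable_history k le_rfl)) ?_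
      rw [MJLS.freeState_eq_state]
      exact MJLS.measurable_state hΦ.1 (fun _ _ => measurable_const)
        (fun _ => measurable_const) x₀ k
    have hle := MJLS.lqCost_le_of_feedback hθ h h0 hA hG hC hP hP0 hPr hwm hfb
    have hadm : w ∈ MJLS.admissible Pr A G θ x₀ := by
      obtain ⟨β, α, hβ, hα0, hα1, hb⟩ := hW.exists_meanSq_le h hΦ
      -- Square summability comes from the finite cost, which dominates `∑ 𝐄‖w(k)‖²`.
      refine ⟨hwm, lt_of_le_of_lt ?_ (hle.trans_lt ENNReal.ofReal_lt_top),
        β, α, hβ, hα0, hα1, fun k => (hx k).symm ▸ hb Ω Pr θ hθ h0 x₀ k⟩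
      rw [MJLS.lqCost_eq_tsum_stageCost]
      exact ENNReal.tsum_le_tsum fun k => lintegral_mono fun ω =>
        ENNReal.ofReal_le_ofReal (le_add_of_nonneg_left (MJLS.sqNorm_nonneg _))
    have hlow : ∀ w' ∈ MJLS.admissible Pr A G θ x₀,
        ENNReal.ofReal (x₀ ⬝ᵥ MJLS.meanInit Pr θ P *ᵥ x₀) ≤ MJLS.lqCost Pr A G C θ x₀ w' :=
      fun w' hw' => MJLS.le_lqCost hθ h h0 hA hG hC hP hP0 hPr hw'
    have heq := le_antisymm hle (hlow w hadm)
    exact ⟨IsLeast.isGLB ⟨⟨w, hadm, heq⟩, by rintro _ ⟨w', hw', rfl⟩; exact hlow w' hw'⟩,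
      w, hadm, hfb, heq⟩
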